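/- **Setting.** Consider the one-dimensional discrete-time quantum walk on $\ell^2(\mathbb Z)\otimes\mathbb C^2$ with one-step evolution $U_\Theta=S(\mathbb 1\otimes C_\Theta)$, where $$S=\sum_{x\in\mathbb Z}\big(|x+1\rangle\langle x|\otimes|0\rangle\langle 0|+|x-1\rangle\langle x|\otimes|1\rangle\langle 1|\big),\qquad C_\Theta=\begin{pmatrix} e^{i\alpha}\cos\theta & e^{i\beta}\sin\theta\\ -e^{-i\beta}\sin\theta & e^{-i\alpha}\cos\theta\end{pmatrix},$$ with real parameters $\Theta=(\theta,\alpha,\beta)$ such that $\sin\theta\neq 0$. Let $\Psi(0)$ be a unit vector that does not depend on $\Theta$, let $\Psi_\Theta(t)=U_\Theta^t\Psi(0)$ and $\varrho_\Theta(t)=|\Psi_\Theta(t)\rangle\langle\Psi_\Theta(t)|$ for $t\in\mathbb N$. For $\mu\in\{\theta,\alpha,\beta\}$ a symmetric logarithmic derivative $L_\mu$ is a bounded self-adjoint operator with $\partial_\mu\varrho_\Theta=\frac12\{L_\mu,\varrho_\Theta\}$; the quantum Fisher information matrix and the Uhlmann curvature matrix are $$F_{\mu\nu}(t)=\tfrac12\operatorname{Tr}\big(\varrho_\Theta\{L_\mu,L_\nu\}\big),\qquad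 \mathcal U_{\mu\nu}(t)=-\tfrac i2\operatorname{Tr}\big(\varrho_\Theta[L_\mu,L_\nu]\big).$$ For $k\in(-\pi,\pi]$ put $u_k=\operatorname{diag}(e^{-ik},e^{ik})\,C_\Theta$, $O_\mu=u_k^\dagger\,\partial_\mu u_k$, $\varphi_k(0)=\sum_x e^{-ikx}\langle x|\Psi(0)\rangle\in\mathbb C^2$ (an $L^2$-convergent Fourier series) and $\varrho_0=\varrho_0(k)=|\varphi_k(0)\rangle\langle\varphi_k(0)|$. For a $2\times2$ matrix $O$ let $|O)=(\operatorname{Tr}(O\sigma_i))_{i=0,x,y,z}\in\mathbb C^4$, with $\sigma_0=\mathbb 1$ and the Pauli matrices, let $(O|$ be its conjugate transpose, and let $\tilde{\mathcal A}_k$ be the $4\times 4$ matrix with $\tilde{\mathcal A}_k|O)=|u_kOu_k^\dagger)$. Finally let $$\mathcal A_k^{\mathbb 1}=N\begin{pmatrix}\frac1N&0&0&0\\0&\sin^2(k-\beta)&-\cos(k-\beta)\sin(k-\beta)&\cot\theta\sin(k-\beta)\sin(k-\alpha)\\0&-\cos(k-\beta)\sin(k-\beta)&\cos^2(k-\beta)&-\cot\theta\cos(k-\beta)\sin(k-\alpha)\\0&\cot\theta\sin(k-\beta)\sin(k-\alpha)&-\cot\theta\cos(k-\beta)\sin(k-\alpha)&\cot^2\theta\sin^2(k-\alpha)\end{pmatrix},\qquad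 N=\frac{\sin^2\theta}{1-\cos^2\theta\cos^2(k-\alpha)}.$$ **Theorem.** For every $k$, $\mathcal A_k^{\mathbb 1}$ is the orthogonal projector onto the eigenspace of $\tilde{\mathcal A}_k$ for the eigenvalue $1$. For every $t$ and $\mu$ a symmetric logarithmic derivative exists, and for every choice of them and all $\mu,\nu\in\{\theta,\alpha,\beta\}$: 1. $\displaystyle\lim_{t\to\infty}\frac{F_{\mu\nu}(t)}{t^2}=\int_{-\pi}^{\pi}\frac{dk}{2\pi}\operatorname{Tr}(\varrho_0)\,(O_\mu|\mathcal A_k^{\mathbb 1}|O_\nu)-\Big(\int_{-\pi}^{\pi}\frac{dk}{2\pi}(O_\mu|\mathcal A_k^{\mathbb 1}|\varrho_0)\Big)\Big(\int_{-\pi}^{\pi}\frac{dk}{2\pi}(\varrho_0|\mathcal A_k^{\mathbb 1}|O_\nu)\Big).$ 2. In particular, if $\operatorname{Tr}\varrho_0(k)=1$ for almost every $k$ (for example, for a walker that starts at a single site), then $$\lim_{t\to\infty}\frac{F_{\mu\nu}(t)}{t^2}=\int_{-\pi}^{\pi}\frac{dk}{2\pi}(O_\mu|\mathcal A_k^{\mathbb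 1}|O_\nu)-\Big(\int_{-\pi}^{\pi}\frac{dk}{2\pi}(O_\mu|\mathcal A_k^{\mathbb 1}|\varrho_0)\Big)\Big(\int_{-\pi}^{\pi}\frac{dk}{2\pi}(\varrho_0|\mathcal A_k^{\mathbb 1}|O_\nu)\Big).$$ 3. $\displaystyle\lim_{t\to\infty}\frac{\mathcal U_{\mu\nu}(t)}{t^2}=0.$ -/

import Mathlib

open Real Filter Topology MeasureTheory Matrix
open scoped InnerProductSpace

namespace QWalk

noncomputable section

/-! ### Lattice, coin, and the one-step evolution -/

/-- The labels of the three unknown real parameters of the coin. -/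
inductive CoinParam where
  | theta
  | alpha
  | beta
  deriving DecidableEq

/-- A value of the three parameters. -/
abbrev Params := CoinParam → ℝ

/-- The position space `ℓ²(ℤ)`. -/
abbrev Position := lp (fun _ : ℤ => ℂ) 2

/-- The lattice-coin space `ℓ²(ℤ) ⊗ ℂ²`, as two copies of `ℓ²(ℤ)`: the component `ψ j` holds the
amplitudes `c_{x,j} = ψ j x` of `|x⟩ ⊗ |j⟩`. -/
abbrev Walker := PiLp 2 (fun _ : Fin 2 => Position)

/-- The basis vector `|x⟩ ⊗ |j⟩`. -/
def ket (x : ℤ) (j : Fin 2) : Walker := PiLp.single 2 j (lp.single 2 x (1 : ℂ))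

/-- The translation `|x⟩ ↦ |x + a⟩` of `ℓ²(ℤ)`, that is `(T_a f)(x) = f (x - a)`. -/
def latticeTranslate (a : ℤ) : Position →ₗᵢ[ℂ] Position where
  toFun f := ⟨fun x => f (x - a), by
    have h := (memℓp_gen_iff (p := 2) (by norm_num)).mp (lp.memℓp f)
    exact (memℓp_gen_iff (p := 2) (by norm_num)).mpr ((Equiv.subRight a).summable_iff.mpr h)⟩
  map_add' f g := by ext x; rfl
  map_smul' c f := by ext x; rfl
  norm_map' f := by
    rw [lp.norm_eq_tsum_rpow (by norm_num), lp.norm_eq_tsum_rpow (by norm_num)]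
    congr 1
    exact (Equiv.subRight a).tsum_eq (fun x => ‖f x‖ ^ (2 : ENNReal).toReal)

/-- The coin matrix `C_{θ,α,β}`. -/
def coin (Θ : Params) : Matrix (Fin 2) (Fin 2) ℂ :=
  !![Complex.exp (Complex.I * Θ .alpha) * Real.cos (Θ .theta),
      Complex.exp (Complex.I * Θ .beta) * Real.sin (Θ .theta);
    -(Complex.exp (-(Complex.I * Θ .beta)) * Real.sin (Θ .theta)),
      Complex.exp (-(Complex.I * Θ .alpha)) * Real.cos (Θ .theta)]

/-- The operator `𝟙 ⊗ C` on the lattice-coin space. -/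
def coinOp (C : Matrix (Fin 2) (Fin 2) ℂ) : Walker →L[ℂ] Walker :=
  (PiLp.continuousLinearEquiv 2 ℂ (fun _ : Fin 2 => Position)).symm.toContinuousLinearMap ∘L
    ContinuousLinearMap.pi (fun i => ∑ j, C i j • PiLp.proj 2 (fun _ : Fin 2 => Position) j)

/-- The conditional shift `S = ∑ₓ |x+1⟩⟨x| ⊗ |0⟩⟨0| + |x-1⟩⟨x| ⊗ |1⟩⟨1|`. -/
def shiftOp : Walker →L[ℂ] Walker :=
  (PiLp.continuousLinearEquiv 2 ℂ (fun _ : Fin 2 => Position)).symm.toContinuousLinearMap ∘L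
    ContinuousLinearMap.pi (fun i =>
      (latticeTranslate (![1, -1] i)).toContinuousLinearMap ∘L
        PiLp.proj 2 (fun _ : Fin 2 => Position) i)

/-- The one-step evolution `U_Θ = S (𝟙 ⊗ C_Θ)`. -/
def evolution (Θ : Params) : Walker →L[ℂ] Walker := shiftOp ∘L coinOp (coin Θ)

/-- The state `|Ψ_Θ(t)⟩ = U_Θ^t |Ψ(0)⟩` after `t` steps. -/
def stateAt (Ψ₀ : Walker) (t : ℕ) (Θ : Params) : Walker := (evolution Θ ^ t) Ψ₀

/-- The density operator `|Ψ_Θ(t)⟩⟨Ψ_Θ(t)|` after `t` steps. -/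
def densityAt (Ψ₀ : Walker) (t : ℕ) (Θ : Params) : Walker →L[ℂ] Walker :=
  InnerProductSpace.rankOne ℂ (stateAt Ψ₀ t Θ) (stateAt Ψ₀ t Θ)

/-! ### Quantum Fisher information and Uhlmann curvature -/

/-- The trace `∑_{x,j} ⟨x,j| T |x,j⟩` (used below for finite-rank operators only). -/
def opTrace (T : Walker →L[ℂ] Walker) : ℂ :=
  ∑' p : ℤ × Fin 2, ⟪ket p.1 p.2, T (ket p.1 p.2)⟫_ℂ

/-- `L` is a symmetric logarithmic derivative, with respect to the parameter `μ` and at the point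
`Θ`, of the family `ρ` of density operators: `L` is self-adjoint, and the partial derivative
`∂_μ ρ` (in operator norm) exists at `Θ` and equals `½ {L, ρ_Θ}`. -/
def IsSLD (ρ : Params → Walker →L[ℂ] Walker) (Θ : Params) (μ : CoinParam)
    (L : Walker →L[ℂ] Walker) : Prop :=
  IsSelfAdjoint L ∧
    HasDerivAt (fun s : ℝ => ρ (Function.update Θ μ s))
      ((1 / 2 : ℂ) • (L * ρ Θ + ρ Θ * L)) (Θ μ)

/-- The quantum Fisher information `½ Tr (ρ {L₁, L₂})`. -/
def qfi (ρ L₁ L₂ : Walker →L[ℂ] Walker) : ℂ :=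
  (1 / 2 : ℂ) * opTrace (ρ * (L₁ * L₂ + L₂ * L₁))

/-- The Uhlmann curvature `-(i/2) Tr (ρ [L₁, L₂])`. -/
def uhlmann (ρ L₁ L₂ : Walker →L[ℂ] Walker) : ℂ :=
  -(Complex.I / 2) * opTrace (ρ * (L₁ * L₂ - L₂ * L₁))

/-! ### Momentum space -/

instance : Fact (0 < 2 * π) := ⟨Real.two_pi_pos⟩

/-- The initial amplitude `φ_k(0) = ⟨k|Ψ(0)⟩ = ∑ₓ e^{-ikx} (c_{x,0}, c_{x,1})`. The series
converges in `L²(dk/2π)` on the circle `ℝ/2πℤ`, and `φ` is defined for almost every `k`. -/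
def amplitude (Ψ₀ : Walker) (k : ℝ) (j : Fin 2) : ℂ :=
  ((fourierBasis (T := 2 * π)).repr.symm (Ψ₀ j) : AddCircle (2 * π) → ℂ)
    ((-k : ℝ) : AddCircle (2 * π))

/-- The coin operator `ϱ₀ = |φ_k(0)⟩⟨φ_k(0)|` of the initial state at momentum `k`. -/
def rhoZero (Ψ₀ : Walker) (k : ℝ) : Matrix (Fin 2) (Fin 2) ℂ :=
  vecMulVec (amplitude Ψ₀ k) (star (amplitude Ψ₀ k))

/-- The step `u_k = (e^{-ik} |0⟩⟨0| + e^{ik} |1⟩⟨1|) C_Θ` at momentum `k`. -/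
def stepAt (k : ℝ) (Θ : Params) : Matrix (Fin 2) (Fin 2) ℂ :=
  diagonal ![Complex.exp (-(Complex.I * k)), Complex.exp (Complex.I * k)] * coin Θ

/-- `O_μ = u_k† ∂_μ u_k`. -/
def genAt (k : ℝ) (Θ : Params) (μ : CoinParam) : Matrix (Fin 2) (Fin 2) ℂ :=
  (stepAt k Θ)ᴴ *
    Matrix.of fun i j => deriv (fun s : ℝ => stepAt k (Function.update Θ μ s) i j) (Θ μ)

/-! ### Bloch representation -/

/-- `σ₀ = 𝟙, σ_x, σ_y, σ_z`. -/
def pauli : Fin 4 → Matrix (Fin 2) (Fin 2) ℂ :=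
  ![1, !![0, 1; 1, 0], !![0, -Complex.I; Complex.I, 0], !![1, 0; 0, -1]]

/-- The vector `|O) = (Tr (O σ_i))_i` of coefficients of `O = ½ ∑ᵢ oᵢ σᵢ`. -/
def bloch (O : Matrix (Fin 2) (Fin 2) ℂ) : Fin 4 → ℂ := fun i => (O * pauli i).trace

/-- The matrix, acting on vectors `|O)`, of the superoperator `O ↦ u_k O u_k†`. -/
def superop (k : ℝ) (Θ : Params) : Matrix (Fin 4) (Fin 4) ℂ :=
  Matrix.of fun i j => bloch (stepAt k Θ * ((1 / 2 : ℂ) • pauli j) * (stepAt k Θ)ᴴ) i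

/-- `N = sin² θ / (1 - cos² θ cos² (k - α))`. -/
def normFactor (k : ℝ) (Θ : Params) : ℝ :=
  Real.sin (Θ .theta) ^ 2 /
    (1 - Real.cos (Θ .theta) ^ 2 * Real.cos (k - Θ .alpha) ^ 2)

/-- The explicit matrix `A_k^𝟙`, for real entries. -/
def projRe (k : ℝ) (Θ : Params) : Matrix (Fin 4) (Fin 4) ℝ :=
  let N := normFactor k Θ
  let ct := Real.cot (Θ .theta)
  let sb := Real.sin (k - Θ .beta)
  let cb := Real.cos (k - Θ .beta)
  let sa := Real.sin (k - Θ .alpha)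
  N • !![1 / N, 0, 0, 0;
    0, sb ^ 2, -cb * sb, ct * sb * sa;
    0, -cb * sb, cb ^ 2, -ct * cb * sa;
    0, ct * sb * sa, -ct * cb * sa, ct ^ 2 * sa ^ 2]

/-- The explicit matrix `A_k^𝟙`, acting on complex vectors. -/
def projOne (k : ℝ) (Θ : Params) : Matrix (Fin 4) (Fin 4) ℂ :=
  (projRe k Θ).map (fun r : ℝ => (r : ℂ))

/-- `(A| A_k^𝟙 |B)`, where `(A|` is the conjugate transpose of `|A)`. -/
def form (k : ℝ) (Θ : Params) (A B : Matrix (Fin 2) (Fin 2) ℂ) : ℂ :=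
  star (bloch A) ⬝ᵥ (projOne k Θ *ᵥ bloch B)

/-- `∫_{-π}^{π} f(k) dk/(2π)`. -/
def kInt (f : ℝ → ℂ) : ℂ := ∫ k in (-π)..π, f k / (2 * π)

end

end QWalk

/-! In momentum space the walk splits into the 2×2 unitaries `u_k`, and the product rule gives `∂_μ
ψ(t)` the amplitude `u^t (∑_{s<t} u^{-s} O_μ u^s) φ_k(0)` (`amplitude_stateDeriv`). Everything then
rests on the ergodic average of `O_μ` under conjugation by a single `SU(2)` element.

Write `u_k = c - i q·σ`. Since `sin θ ≠ 0`, the axis `q` never vanishes, so the commutant of `u_k`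
is spanned by `1` and `W = u_k - u_k†`, and `A_k^𝟙` is the projection onto it in Bloch coordinates.
A traceless `O` is a multiple of `W` plus a coboundary `R - u†Ru` (`exists_sub_commutantPart_eq`).
Coboundaries telescope, so the orbit sum is `t` times the commutant part up to an error bounded in
`t` (`orbitSum_sub`). The averages are also bounded uniformly in `k` and `t`, because `O_μ` does not
depend on `k`; dominated convergence therefore gives the limits of `⟨∂_μψ, ∂_νψ⟩/t²` and `⟨ψ,
∂_μψ⟩/t`.

For a pure state every symmetric logarithmic derivative acts on `ψ` in the same way
(`apply_eq_of_anticommutator_eq`), so `F` and `𝒰` are the symmetric and antisymmetric parts of one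
geometric tensor. Its scaled limit is symmetric (`asymptoticTensor_comm`): commutant parts are
multiples of the same `W`, and `Tr(O_μ W)` is real. Hence `F/t²` has this limit and `𝒰/t²` tends to
zero. -/

namespace QWalk

/-! ### The step at fixed momentum as an element of `SU(2)` -/

/-- The scalar part `½ Tr u_k` of the step. -/
noncomputable def scalarPart (k : ℝ) (Θ : Params) : ℝ :=
  Real.cos (Θ .theta) * Real.cos (k - Θ .alpha)

/-- The vector `q` with `u_k = ½ Tr u_k - i q · σ`. -/
noncomputable def axis (k : ℝ) (Θ : Params) : Fin 3 → ℝ :=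
  ![Real.sin (Θ .theta) * Real.sin (k - Θ .beta), -(Real.sin (Θ .theta) * Real.cos (k - Θ .beta)),
    Real.cos (Θ .theta) * Real.sin (k - Θ .alpha)]

/-- The squared length of the rotation axis. -/
noncomputable def axisSq (k : ℝ) (Θ : Params) : ℝ :=
  axis k Θ 0 ^ 2 + axis k Θ 1 ^ 2 + axis k Θ 2 ^ 2

/-- The matrix `c - i q · σ`. -/
def rotor (c : ℝ) (q : Fin 3 → ℝ) : Matrix (Fin 2) (Fin 2) ℂ :=
  !![c - Complex.I * q 2, -(Complex.I * q 0) - q 1; -(Complex.I * q 0) + q 1, c + Complex.I * q 2]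

/-- The phases of the shift and the coin combine to `e^{∓i(k-α)}` on the diagonal and `e^{∓i(k-β)}`
off it. -/
lemma stepAt_eq_rotor (k : ℝ) (Θ : Params) :
    stepAt k Θ = rotor (scalarPart k Θ) (axis k Θ) := by
  have h : ∀ a b : ℝ, Complex.exp (-(Complex.I * a)) * Complex.exp (Complex.I * b) =
      Real.cos (a - b) - Complex.I * Real.sin (a - b) := by
    intro a b
    rw [← Complex.exp_add, show -(Complex.I * a) + Complex.I * b = ((-(a - b) : ℝ) : ℂ) * Complex.I
      by push_cast; ring, Complex.exp_mul_I, ← Complex.ofReal_cos, ← Complex.ofReal_sin,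
      Real.cos_neg, Real.sin_neg]
    push_cast; ring
  have h' : ∀ a b : ℝ, Complex.exp (Complex.I * a) * Complex.exp (-(Complex.I * b)) =
      Real.cos (a - b) + Complex.I * Real.sin (a - b) := by
    intro a b
    rw [← Complex.exp_add, show Complex.I * a + -(Complex.I * b) = ((a - b : ℝ) : ℂ) * Complex.I
      by push_cast; ring, Complex.exp_mul_I, ← Complex.ofReal_cos, ← Complex.ofReal_sin]
    ring
  ext i j
  fin_cases i <;> fin_cases j <;>
    simp only [stepAt, coin, diagonal_mul, rotor, scalarPart, axis, Fin.zero_eta, Fin.mk_one,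
      of_apply, cons_val_zero, cons_val_one, cons_val, mul_neg, ← mul_assoc, h, h'] <;>
    push_cast <;> ring

lemma scalarPart_sq_add_axisSq (k : ℝ) (Θ : Params) :
    scalarPart k Θ ^ 2 + axisSq k Θ = 1 := by
  simp only [scalarPart, axisSq, axis, cons_val_zero, cons_val_one, cons_val]
  have h1 := Real.sin_sq_add_cos_sq (Θ .theta)
  have h2 := Real.sin_sq_add_cos_sq (k - Θ .alpha)
  have h3 := Real.sin_sq_add_cos_sq (k - Θ .beta)
  linear_combination (Real.cos (Θ .theta)) ^ 2 * h2 + (Real.sin (Θ .theta)) ^ 2 * h3 + h1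

lemma axisSq_eq (k : ℝ) (Θ : Params) :
    axisSq k Θ = Real.sin (Θ .theta) ^ 2 + (Real.cos (Θ .theta) * Real.sin (k - Θ .alpha)) ^ 2 := by
  simp only [axisSq, axis, cons_val_zero, cons_val_one, cons_val]
  linear_combination (Real.sin (Θ .theta)) ^ 2 * Real.sin_sq_add_cos_sq (k - Θ .beta)

/-- The bound `|q|² ≥ sin² θ` keeps `u_k` away from `±1`, where the commutant would jump to all
matrices. -/
lemma axisSq_pos {Θ : Params} (hθ : Real.sin (Θ .theta) ≠ 0) (k : ℝ) : 0 < axisSq k Θ := by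
  rw [axisSq_eq]; positivity

lemma stepAt_conjTranspose_mul (k : ℝ) (Θ : Params) : (stepAt k Θ)ᴴ * stepAt k Θ = 1 := by
  have h := congrArg (fun x : ℝ => (x : ℂ)) (scalarPart_sq_add_axisSq k Θ)
  simp only [axisSq] at h
  push_cast at h
  rw [stepAt_eq_rotor]
  ext i j
  fin_cases i <;> fin_cases j <;>
    simp [rotor, Matrix.mul_apply, Fin.sum_univ_two, conjTranspose_apply] <;>
    first
    | linear_combination h - ((axis k Θ 0 : ℂ) ^ 2 + (axis k Θ 2 : ℂ) ^ 2) * Complex.I_sq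
    | ring1

lemma stepAt_mul_conjTranspose (k : ℝ) (Θ : Params) : stepAt k Θ * (stepAt k Θ)ᴴ = 1 :=
  mul_eq_one_comm.mp (stepAt_conjTranspose_mul k Θ)

/-- The denominator of `N` is `1 - c² = |q|²`, which exposes `A_k^𝟙` as `1 ⊕ q qᵀ/|q|²`: the
projection onto the identity and the rotation axis. -/
lemma projRe_eq {Θ : Params} (hθ : Real.sin (Θ .theta) ≠ 0) (k : ℝ) :
    projRe k Θ = !![1, 0, 0, 0;
      0, axis k Θ 0 * axis k Θ 0 / axisSq k Θ, axis k Θ 0 * axis k Θ 1 / axisSq k Θ,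
        axis k Θ 0 * axis k Θ 2 / axisSq k Θ;
      0, axis k Θ 1 * axis k Θ 0 / axisSq k Θ, axis k Θ 1 * axis k Θ 1 / axisSq k Θ,
        axis k Θ 1 * axis k Θ 2 / axisSq k Θ;
      0, axis k Θ 2 * axis k Θ 0 / axisSq k Θ, axis k Θ 2 * axis k Θ 1 / axisSq k Θ,
        axis k Θ 2 * axis k Θ 2 / axisSq k Θ] := by
  have hQ := (axisSq_pos hθ k).ne'
  have hN : normFactor k Θ = Real.sin (Θ .theta) ^ 2 / axisSq k Θ := by
    rw [normFactor]
    congr 1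
    have := scalarPart_sq_add_axisSq k Θ
    rw [scalarPart] at this
    linear_combination -this
  ext i j
  fin_cases i <;> fin_cases j <;>
    simp [projRe, hN, axis, Real.cot_eq_cos_div_sin] <;> field_simp

lemma projOne_isHermitian (k : ℝ) {Θ : Params} (hθ : Real.sin (Θ .theta) ≠ 0) :
    (projOne k Θ).IsHermitian := by
  rw [projOne, projRe_eq hθ]
  ext i j
  fin_cases i <;> fin_cases j <;> simp [conjTranspose_apply, mul_comm]

lemma projOne_mul_self (k : ℝ) {Θ : Params} (hθ : Real.sin (Θ .theta) ≠ 0) :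
    projOne k Θ * projOne k Θ = projOne k Θ := by
  have hQ := (axisSq_pos hθ k).ne'
  have h : projRe k Θ * projRe k Θ = projRe k Θ := by
    rw [projRe_eq hθ]
    ext i j
    fin_cases i <;> fin_cases j <;> simp [Matrix.mul_apply, Fin.sum_univ_four] <;>
      field_simp <;> rw [axisSq] <;> ring
  rw [projOne]
  conv_rhs => rw [← h]
  exact (Matrix.map_mul (f := Complex.ofRealHom)).symm

lemma bloch_injective : Function.Injective bloch := by
  intro A B h
  have h0 := congrFun h 0
  have h1 := congrFun h 1
  have h2 := congrFun h 2
  have h3 := congrFun h 3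
  simp [bloch, pauli, trace_fin_two, Matrix.mul_apply, Fin.sum_univ_two] at h0 h1 h2 h3
  ext i j
  fin_cases i <;> fin_cases j <;> simp
  · linear_combination (h0 + h3) / 2
  · linear_combination (h1 - Complex.I * h2) / 2 + (A 0 1 - A 1 0 - B 0 1 + B 1 0) / 2 * Complex.I_sq
  · linear_combination (h1 + Complex.I * h2) / 2 - (A 0 1 - A 1 0 - B 0 1 + B 1 0) / 2 * Complex.I_sq
  · linear_combination (h0 - h3) / 2

/-- The matrix with given Bloch coefficients. -/
noncomputable def ofBloch (v : Fin 4 → ℂ) : Matrix (Fin 2) (Fin 2) ℂ :=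
  ∑ j, v j • ((1 / 2 : ℂ) • pauli j)

lemma bloch_ofBloch (v : Fin 4 → ℂ) : bloch (ofBloch v) = v := by
  ext i
  fin_cases i <;>
    simp [bloch, ofBloch, pauli, trace_fin_two, Matrix.mul_apply, Fin.sum_univ_two,
      Fin.sum_univ_four, Matrix.add_apply] <;> ring_nf
  simp

lemma superop_mulVec (k : ℝ) (Θ : Params) (v : Fin 4 → ℂ) :
    superop k Θ *ᵥ v = bloch (stepAt k Θ * ofBloch v * (stepAt k Θ)ᴴ) := by
  ext i
  simp only [mulVec, dotProduct, superop, of_apply, bloch, ofBloch, Finset.mul_sum, Finset.sum_mul,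
    trace_sum, Matrix.mul_smul, Matrix.smul_mul, trace_smul, smul_eq_mul]
  exact Finset.sum_congr rfl fun j _ => by ring

lemma superop_mulVec_eq_iff_commute (k : ℝ) (Θ : Params) (v : Fin 4 → ℂ) :
    superop k Θ *ᵥ v = v ↔ stepAt k Θ * ofBloch v = ofBloch v * stepAt k Θ := by
  have h1 := stepAt_conjTranspose_mul k Θ
  have h2 := stepAt_mul_conjTranspose k Θ
  rw [superop_mulVec]
  nth_rw 2 [← bloch_ofBloch v]
  rw [bloch_injective.eq_iff]
  constructor
  · intro h
    nth_rw 2 [← h]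
    rw [Matrix.mul_assoc _ _ (stepAt k Θ), h1, Matrix.mul_one]
  · intro h
    rw [h, Matrix.mul_assoc, h2, Matrix.mul_one]

lemma ofBloch_eq (v : Fin 4 → ℂ) :
    ofBloch v = !![(v 0 + v 3) / 2, (v 1 - Complex.I * v 2) / 2;
      (v 1 + Complex.I * v 2) / 2, (v 0 - v 3) / 2] := by
  ext i j
  fin_cases i <;> fin_cases j <;>
    simp [ofBloch, pauli, Fin.sum_univ_four, Matrix.add_apply] <;> ring

/-- Both conditions say that the vector part of `v` is parallel to `q`; the commutator with `u_k`
encodes the cross product of the two. -/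
lemma projOne_mulVec_eq_iff_commute (k : ℝ) {Θ : Params} (hθ : Real.sin (Θ .theta) ≠ 0)
    (v : Fin 4 → ℂ) :
    projOne k Θ *ᵥ v = v ↔ stepAt k Θ * ofBloch v = ofBloch v * stepAt k Θ := by
  have hQ : (axisSq k Θ : ℂ) ≠ 0 := by exact_mod_cast (axisSq_pos hθ k).ne'
  have hQ' : (axisSq k Θ : ℂ) = (axis k Θ 0 : ℂ) ^ 2 + (axis k Θ 1 : ℂ) ^ 2 + (axis k Θ 2 : ℂ) ^ 2 :=
    by simp [axisSq]
  set q0 : ℂ := ((axis k Θ 0 : ℝ) : ℂ) with hq0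
  set q1 : ℂ := ((axis k Θ 1 : ℝ) : ℂ) with hq1
  set q2 : ℂ := ((axis k Θ 2 : ℝ) : ℂ) with hq2
  have hcross : stepAt k Θ * ofBloch v = ofBloch v * stepAt k Θ ↔
      q1 * v 3 - q2 * v 2 = 0 ∧ q2 * v 1 - q0 * v 3 = 0 ∧ q0 * v 2 - q1 * v 1 = 0 := by
    have hd : stepAt k Θ * ofBloch v - ofBloch v * stepAt k Θ =
        !![q0 * v 2 - q1 * v 1, (q1 * v 3 - q2 * v 2) - Complex.I * (q2 * v 1 - q0 * v 3);
          (q1 * v 3 - q2 * v 2) + Complex.I * (q2 * v 1 - q0 * v 3), -(q0 * v 2 - q1 * v 1)] := by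
      rw [stepAt_eq_rotor, ofBloch_eq]
      ext i j
      fin_cases i <;> fin_cases j <;>
        simp [rotor, ← hq0, ← hq1, ← hq2] <;>
        ring_nf <;> simp <;> ring
    rw [← sub_eq_zero, hd]
    constructor
    · intro h
      have h00 := congrFun (congrFun h 0) 0
      have h01 := congrFun (congrFun h 0) 1
      have h10 := congrFun (congrFun h 1) 0
      simp at h00 h01 h10
      refine ⟨by linear_combination (h01 + h10) / 2, ?_, h00⟩
      have h2 : Complex.I * (q2 * v 1 - q0 * v 3) = 0 := by linear_combination (h10 - h01) / 2
      exact (mul_eq_zero.mp h2).resolve_left Complex.I_ne_zero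
    · rintro ⟨h1, h2, h3⟩
      rw [h1, h2, h3]
      ext i j
      fin_cases i <;> fin_cases j <;> simp
  rw [hcross, projOne, projRe_eq hθ]
  constructor
  · intro h
    have e1 := congrFun h 1
    have e2 := congrFun h 2
    have e3 := congrFun h 3
    simp [mulVec, dotProduct, Fin.sum_univ_four, ← hq0, ← hq1, ← hq2] at e1 e2 e3
    set r : ℂ := (q0 * v 1 + q1 * v 2 + q2 * v 3) / axisSq k Θ with hr
    have e1' : v 1 = q0 * r := by rw [hr]; linear_combination -e1
    have e2' : v 2 = q1 * r := by rw [hr]; linear_combination -e2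
    have e3' : v 3 = q2 * r := by rw [hr]; linear_combination -e3
    clear_value r
    rw [e1', e2', e3']
    refine ⟨?_, ?_, ?_⟩ <;> ring
  -- Conversely, the components of `q × (q × v) = 0` give `q (q·v) = |q|² v`.
  · rintro ⟨h1, h2, h3⟩
    ext i
    fin_cases i <;> simp [mulVec, dotProduct, Fin.sum_univ_four, ← hq0, ← hq1, ← hq2] <;>
      field_simp <;> rw [hQ']
    · linear_combination q1 * h3 - q2 * h2
    · linear_combination q2 * h1 - q0 * h3
    · linear_combination q0 * h2 - q1 * h1

theorem projOne_mulVec_eq_iff (k : ℝ) {Θ : Params} (hθ : Real.sin (Θ .theta) ≠ 0)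
    (v : Fin 4 → ℂ) : projOne k Θ *ᵥ v = v ↔ superop k Θ *ᵥ v = v := by
  rw [projOne_mulVec_eq_iff_commute k hθ, superop_mulVec_eq_iff_commute]

/-! ### The commutant of the step -/

/-- The skew-adjoint, traceless part `u_k - u_k†` of the step, which generates its commutant
together with the identity. -/
noncomputable def skewPart (k : ℝ) (Θ : Params) : Matrix (Fin 2) (Fin 2) ℂ :=
  stepAt k Θ - (stepAt k Θ)ᴴ

lemma skewPart_conjTranspose (k : ℝ) (Θ : Params) : (skewPart k Θ)ᴴ = -skewPart k Θ := by
  simp [skewPart]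

lemma skewPart_eq (k : ℝ) (Θ : Params) :
    skewPart k Θ = !![-2 * Complex.I * axis k Θ 2, -2 * Complex.I * axis k Θ 0 - 2 * axis k Θ 1;
      -2 * Complex.I * axis k Θ 0 + 2 * axis k Θ 1, 2 * Complex.I * axis k Θ 2] := by
  rw [skewPart, stepAt_eq_rotor]
  ext i j
  fin_cases i <;> fin_cases j <;> simp [rotor, conjTranspose_apply] <;> ring

lemma trace_skewPart (k : ℝ) (Θ : Params) : (skewPart k Θ).trace = 0 := by
  simp [skewPart_eq, trace_fin_two]

lemma skewPart_mul_self (k : ℝ) (Θ : Params) :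
    skewPart k Θ * skewPart k Θ = (-4 * axisSq k Θ : ℂ) • (1 : Matrix (Fin 2) (Fin 2) ℂ) := by
  rw [skewPart_eq]
  ext i j
  fin_cases i <;> fin_cases j <;>
    simp [Matrix.mul_apply, Fin.sum_univ_two, axisSq] <;> ring_nf <;> simp <;> ring

lemma skewPart_mul_stepAt (k : ℝ) (Θ : Params) :
    skewPart k Θ * stepAt k Θ = stepAt k Θ * skewPart k Θ := by
  rw [skewPart, sub_mul, mul_sub, stepAt_conjTranspose_mul, stepAt_mul_conjTranspose]

lemma stepAt_add_conjTranspose (k : ℝ) (Θ : Params) :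
    stepAt k Θ + (stepAt k Θ)ᴴ = (2 * scalarPart k Θ : ℂ) • (1 : Matrix (Fin 2) (Fin 2) ℂ) := by
  rw [stepAt_eq_rotor]
  ext i j
  fin_cases i <;> fin_cases j <;> simp [rotor, conjTranspose_apply] <;> ring

/-- Polarized Cayley–Hamilton for 2×2 matrices; trace-orthogonal traceless matrices therefore
anticommute. -/
lemma mul_add_mul_of_trace_eq_zero {A B : Matrix (Fin 2) (Fin 2) ℂ} (hA : A.trace = 0)
    (hB : B.trace = 0) : A * B + B * A = (A * B).trace • (1 : Matrix (Fin 2) (Fin 2) ℂ) := by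
  rw [trace_fin_two] at hA hB
  have hA' : A 1 1 = -A 0 0 := by linear_combination hA
  have hB' : B 1 1 = -B 0 0 := by linear_combination hB
  ext i j
  fin_cases i <;> fin_cases j <;>
    simp [Matrix.mul_apply, Fin.sum_univ_two, trace_fin_two, hA', hB'] <;> ring

/-- The orthogonal projection of a traceless matrix onto the commutant of the step. -/
noncomputable def commutantPart (k : ℝ) (Θ : Params) (O : Matrix (Fin 2) (Fin 2) ℂ) :
    Matrix (Fin 2) (Fin 2) ℂ :=
  (-(O * skewPart k Θ).trace / (8 * axisSq k Θ)) • skewPart k Θ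

lemma commutantPart_mul_stepAt (k : ℝ) (Θ : Params) (O : Matrix (Fin 2) (Fin 2) ℂ) :
    commutantPart k Θ O * stepAt k Θ = stepAt k Θ * commutantPart k Θ O := by
  rw [commutantPart, Matrix.smul_mul, Matrix.mul_smul, skewPart_mul_stepAt]

/-- A traceless matrix differs from its part in the commutant of `u_k` by a coboundary for the
conjugation by `u_k`. -/
lemma exists_sub_commutantPart_eq (k : ℝ) {Θ : Params} (hθ : Real.sin (Θ .theta) ≠ 0)
    {O : Matrix (Fin 2) (Fin 2) ℂ} (hO : O.trace = 0) :
    ∃ R, O - commutantPart k Θ O = R - (stepAt k Θ)ᴴ * R * stepAt k Θ := by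
  have hQ : (axisSq k Θ : ℂ) ≠ 0 := by exact_mod_cast (axisSq_pos hθ k).ne'
  set u := stepAt k Θ with hu
  set W := skewPart k Θ with hW
  set M := O - commutantPart k Θ O with hM
  have hMtr : M.trace = 0 := by
    rw [hM, trace_sub, hO, commutantPart, trace_smul, ← hW, hW, trace_skewPart]; simp
  have hMW : (M * W).trace = 0 := by
    rw [hM, sub_mul, trace_sub, commutantPart, Matrix.smul_mul, skewPart_mul_self, trace_smul,
      trace_smul, trace_one]
    simp only [smul_eq_mul, Fintype.card_fin]
    field_simp
    push_cast
    rw [hW]; ring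
  have hanti : M * W = -(W * M) := by
    have h := mul_add_mul_of_trace_eq_zero hMtr (trace_skewPart k Θ)
    rw [← hW, hMW, zero_smul] at h
    exact eq_neg_of_add_eq_zero_left h
  clear_value M
  have huu : (2 : ℂ) • u = (2 * scalarPart k Θ : ℂ) • (1 : Matrix (Fin 2) (Fin 2) ℂ) + W := by
    rw [← stepAt_add_conjTranspose, hW, skewPart, two_smul]; abel
  have huu' : (2 : ℂ) • uᴴ = (2 * scalarPart k Θ : ℂ) • (1 : Matrix (Fin 2) (Fin 2) ℂ) - W := by
    rw [← stepAt_add_conjTranspose, hW, skewPart, two_smul]; abel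
  -- As `M` anticommutes with `W`, moving it past `u = c + W/2` reverses the rotation.
  have hMu : M * u = uᴴ * M := by
    have : (2 : ℂ) • (M * u) = (2 : ℂ) • (uᴴ * M) := by
      rw [← Matrix.mul_smul, ← Matrix.smul_mul, huu, huu', mul_add, sub_mul, hanti]
      simp [sub_eq_add_neg]
    exact smul_right_injective _ (two_ne_zero) this
  -- For `uWM` the coboundary is `uWM - Wu†M = W(u - u†)M = W²M = -4|q|² M`, which fixes the
  -- constant.
  refine ⟨(-1 / (4 * axisSq k Θ) : ℂ) • (u * W * M), ?_⟩
  have h1 : uᴴ * (u * W * M) * u = W * uᴴ * M := by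
    rw [← Matrix.mul_assoc, ← Matrix.mul_assoc, hu, stepAt_conjTranspose_mul, ← hu, Matrix.one_mul,
      Matrix.mul_assoc, hMu, Matrix.mul_assoc]
  have h2 : u * W * M - W * uᴴ * M = (-4 * axisSq k Θ : ℂ) • M := by
    rw [← sub_mul, hu, hW, ← skewPart_mul_stepAt, ← mul_sub]
    change skewPart k Θ * skewPart k Θ * M = _
    rw [skewPart_mul_self, Matrix.smul_mul, Matrix.one_mul]
  rw [Matrix.mul_smul, Matrix.smul_mul, ← smul_sub, h1, h2, smul_smul]
  have : (-1 / (4 * axisSq k Θ) * (-4 * axisSq k Θ) : ℂ) = 1 := by field_simp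
  rw [this, one_smul]

/-- The sum over `s < t` of the generators `u^{-s} O u^s`. -/
noncomputable def orbitSum (k : ℝ) (Θ : Params) (O : Matrix (Fin 2) (Fin 2) ℂ) (t : ℕ) :
    Matrix (Fin 2) (Fin 2) ℂ :=
  ∑ s ∈ Finset.range t, (stepAt k Θ)ᴴ ^ s * O * stepAt k Θ ^ s

/-- The commutant part is fixed by conjugation and the coboundary telescopes. One `R` serves all
`t`, so the deviation stays bounded. -/
lemma orbitSum_sub (k : ℝ) {Θ : Params} (hθ : Real.sin (Θ .theta) ≠ 0)
    {O : Matrix (Fin 2) (Fin 2) ℂ} (hO : O.trace = 0) :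
    ∃ R, ∀ t : ℕ, orbitSum k Θ O t - (t : ℂ) • commutantPart k Θ O =
      R - (stepAt k Θ)ᴴ ^ t * R * stepAt k Θ ^ t := by
  obtain ⟨R, hR⟩ := exists_sub_commutantPart_eq k hθ hO
  refine ⟨R, fun t => ?_⟩
  have hinv : ∀ s : ℕ, (stepAt k Θ)ᴴ ^ s * commutantPart k Θ O * stepAt k Θ ^ s =
      commutantPart k Θ O := by
    intro s
    have hc : Commute (commutantPart k Θ O) (stepAt k Θ) := commutantPart_mul_stepAt k Θ O
    have hc' : Commute (stepAt k Θ)ᴴ (stepAt k Θ) := by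
      rw [Commute, SemiconjBy, stepAt_conjTranspose_mul, stepAt_mul_conjTranspose]
    rw [Matrix.mul_assoc, (hc.pow_right s).eq, ← Matrix.mul_assoc, ← hc'.mul_pow,
      stepAt_conjTranspose_mul, one_pow, Matrix.one_mul]
  induction t with
  | zero => simp [orbitSum]
  | succ t ih =>
    have hstep : (stepAt k Θ)ᴴ ^ t * O * stepAt k Θ ^ t = commutantPart k Θ O +
        ((stepAt k Θ)ᴴ ^ t * R * stepAt k Θ ^ t -
          (stepAt k Θ)ᴴ ^ (t + 1) * R * stepAt k Θ ^ (t + 1)) := by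
      have hsplit : (stepAt k Θ)ᴴ ^ t * O * stepAt k Θ ^ t =
          (stepAt k Θ)ᴴ ^ t * commutantPart k Θ O * stepAt k Θ ^ t +
            (stepAt k Θ)ᴴ ^ t * (O - commutantPart k Θ O) * stepAt k Θ ^ t := by
        rw [← add_mul, ← mul_add, add_sub_cancel]
      rw [hsplit, hinv, hR, mul_sub, sub_mul, pow_succ, pow_succ' (stepAt k Θ)]
      simp only [Matrix.mul_assoc]
    rw [orbitSum, Finset.sum_range_succ, ← orbitSum, hstep]
    have : ((t + 1 : ℕ) : ℂ) • commutantPart k Θ O =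
        (t : ℂ) • commutantPart k Θ O + commutantPart k Θ O := by
      push_cast; rw [add_smul, one_smul]
    rw [this]
    rw [sub_eq_iff_eq_add] at ih
    rw [ih]
    abel

/-- Since `W = -2i q·σ`, traces against `1` and `W` read off the two components that `A_k^𝟙` keeps.
Later computations need only these traces. -/
lemma form_eq (k : ℝ) {Θ : Params} (hθ : Real.sin (Θ .theta) ≠ 0)
    (A B : Matrix (Fin 2) (Fin 2) ℂ) :
    form k Θ A B = star A.trace * B.trace +
      star (A * skewPart k Θ).trace * (B * skewPart k Θ).trace / (4 * axisSq k Θ) := by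
  have hQ : (axisSq k Θ : ℂ) ≠ 0 := by exact_mod_cast (axisSq_pos hθ k).ne'
  have h : ∀ A : Matrix (Fin 2) (Fin 2) ℂ, (A * skewPart k Θ).trace =
      -2 * Complex.I * (axis k Θ 0 * bloch A 1 + axis k Θ 1 * bloch A 2 + axis k Θ 2 * bloch A 3) := by
    intro A
    rw [skewPart_eq]
    simp [bloch, pauli, trace_fin_two, Matrix.mul_apply, Fin.sum_univ_two]
    ring_nf; simp; ring
  have h0 : ∀ A : Matrix (Fin 2) (Fin 2) ℂ, A.trace = bloch A 0 := by
    intro A; simp [bloch, pauli]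
  rw [h, h, h0, h0, form, projOne, projRe_eq hθ]
  simp [mulVec, dotProduct, Fin.sum_univ_four]
  field_simp
  ring_nf
  simp

/-! ### Fourier transform of the walker -/

/-- Lebesgue measure on the Brillouin zone `(-π, π]`. -/
noncomputable abbrev zone : Measure ℝ := volume.restrict (Set.Ioc (-π) π)

lemma measurePreserving_neg_coe :
    MeasurePreserving (fun k : ℝ => ((-k : ℝ) : AddCircle (2 * π))) zone volume := by
  have h := AddCircle.measurePreserving_mk (2 * π) (-π)
  rw [show -π + 2 * π = π by ring] at h
  exact (Measure.measurePreserving_neg (volume : Measure (AddCircle (2 * π)))).comp h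

lemma ae_zone_of_ae_circle {P : AddCircle (2 * π) → Prop}
    (h : ∀ᵐ x ∂(AddCircle.haarAddCircle : Measure (AddCircle (2 * π))), P x) :
    ∀ᵐ k ∂zone, P ((-k : ℝ) : AddCircle (2 * π)) := by
  refine measurePreserving_neg_coe.quasiMeasurePreserving.ae ?_
  rw [AddCircle.volume_eq_smul_haarAddCircle]
  exact Measure.ae_smul_measure h _

lemma kInt_eq (f : ℝ → ℂ) : kInt f = (2 * π : ℂ)⁻¹ * ∫ k, f k ∂zone := by
  rw [kInt, intervalIntegral.integral_of_le (by linarith [Real.pi_pos])]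
  simp_rw [div_eq_inv_mul]
  exact integral_const_mul _ _

/-- The inverse of the Fourier coefficient map. -/
noncomputable abbrev synth : Position ≃ₗᵢ[ℂ] Lp ℂ 2 (AddCircle.haarAddCircle (T := 2 * π)) :=
  (fourierBasis (T := 2 * π)).repr.symm

/-- Parseval, transported from the circle to `(-π, π]` by `k ↦ -k`; the reflection accounts for the
sign in `e^{-ikx}`. -/
lemma kInt_synth (f g : Position) :
    Integrable (fun k : ℝ => star (synth f ((-k : ℝ) : AddCircle (2 * π))) *
      synth g ((-k : ℝ) : AddCircle (2 * π))) zone ∧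
    kInt (fun k => star (synth f ((-k : ℝ) : AddCircle (2 * π))) *
      synth g ((-k : ℝ) : AddCircle (2 * π))) = ⟪f, g⟫_ℂ := by
  have h1 := L2.integrable_inner (𝕜 := ℂ) (synth f) (synth g)
  have h2 : Integrable (fun x : AddCircle (2 * π) => ⟪synth f x, synth g x⟫_ℂ) volume := by
    rw [AddCircle.volume_eq_smul_haarAddCircle]
    exact h1.smul_measure ENNReal.ofReal_ne_top
  have h3 : ∀ k : ℝ, star (synth f ((-k : ℝ) : AddCircle (2 * π))) *
      synth g ((-k : ℝ) : AddCircle (2 * π)) =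
      (fun x : AddCircle (2 * π) => ⟪synth f x, synth g x⟫_ℂ) ((-k : ℝ) : AddCircle (2 * π)) := by
    intro k
    exact (mul_comm _ _).trans (RCLike.inner_apply _ _).symm
  simp_rw [h3]
  refine ⟨measurePreserving_neg_coe.integrable_comp_of_integrable h2, ?_⟩
  have h4 := integral_map (μ := zone) measurePreserving_neg_coe.measurable.aemeasurable
    (f := fun x : AddCircle (2 * π) => ⟪synth f x, synth g x⟫_ℂ)
    (by rw [measurePreserving_neg_coe.map_eq]; exact h2.aestronglyMeasurable)
  rw [measurePreserving_neg_coe.map_eq] at h4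
  rw [kInt_eq, ← h4, ← LinearIsometryEquiv.inner_map_map synth f g, L2.inner_def,
    AddCircle.integral_haarAddCircle, Complex.real_smul]
  push_cast
  rfl

lemma inner_eq_kInt (Ψ Φ : Walker) :
    Integrable (fun k : ℝ => star (amplitude Ψ k) ⬝ᵥ amplitude Φ k) zone ∧
    ⟪Ψ, Φ⟫_ℂ = kInt (fun k => star (amplitude Ψ k) ⬝ᵥ amplitude Φ k) := by
  have h := fun j => kInt_synth (Ψ j) (Φ j)
  have he : (fun k : ℝ => star (amplitude Ψ k) ⬝ᵥ amplitude Φ k) = fun k : ℝ =>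
      star (synth (Ψ 0) ((-k : ℝ) : AddCircle (2 * π))) *
        synth (Φ 0) ((-k : ℝ) : AddCircle (2 * π)) +
      star (synth (Ψ 1) ((-k : ℝ) : AddCircle (2 * π))) *
        synth (Φ 1) ((-k : ℝ) : AddCircle (2 * π)) := by
    ext k
    simp only [dotProduct, Fin.sum_univ_two, Pi.star_apply, amplitude]
  rw [he]
  refine ⟨(h 0).1.add (h 1).1, ?_⟩
  rw [kInt_eq, integral_add (h 0).1 (h 1).1, mul_add, ← kInt_eq, ← kInt_eq, (h 0).2, (h 1).2,
    PiLp.inner_apply, Fin.sum_univ_two]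

lemma synth_latticeTranslate (a : ℤ) (f : Position) :
    synth (latticeTranslate a f) =ᵐ[AddCircle.haarAddCircle] fun x => fourier a x * synth f x := by
  have hmem : MemLp (fun x : AddCircle (2 * π) => fourier a x * synth f x) 2
      AddCircle.haarAddCircle := by
    refine (Lp.memLp (synth f)).of_le ?_ (ae_of_all _ fun x => ?_)
    · exact (fourier a).continuous.aestronglyMeasurable.mul (Lp.aestronglyMeasurable _)
    · rw [norm_mul, fourier_apply, Circle.norm_coe, one_mul]
  -- The two sides are identified through their Fourier coefficients: multiplication by the `a`-th
  -- monomial shifts the index by `a`.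
  have heq : synth (latticeTranslate a f) = hmem.toLp := by
    rw [LinearIsometryEquiv.symm_apply_eq]
    ext n
    rw [fourierBasis_repr, fourierCoeff_congr_ae hmem.coeFn_toLp]
    have h1 : (latticeTranslate a f) n = fourierCoeff (T := 2 * π) (synth f) (n - a) := by
      rw [← fourierBasis_repr, LinearIsometryEquiv.apply_symm_apply]
      rfl
    rw [h1, fourierCoeff, fourierCoeff]
    congr 1
    ext x
    rw [smul_eq_mul, smul_eq_mul, ← mul_assoc, ← fourier_add]
    congr 2
    ring_nf
  rw [heq]
  exact hmem.coeFn_toLp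

lemma amplitude_add (Ψ Φ : Walker) :
    ∀ᵐ k ∂zone, amplitude (Ψ + Φ) k = amplitude Ψ k + amplitude Φ k := by
  have h : ∀ j, ∀ᵐ k ∂zone, amplitude (Ψ + Φ) k j = amplitude Ψ k j + amplitude Φ k j := by
    intro j
    have := Lp.coeFn_add (synth (Ψ j)) (synth (Φ j))
    rw [← map_add] at this
    exact ae_zone_of_ae_circle this
  filter_upwards [ae_all_iff.mpr h] with k hk
  ext j; exact hk j

lemma coinOp_apply (C : Matrix (Fin 2) (Fin 2) ℂ) (Ψ : Walker) (i : Fin 2) :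
    coinOp C Ψ i = C i 0 • Ψ 0 + C i 1 • Ψ 1 := by
  simp [coinOp, Fin.sum_univ_two]

lemma shiftOp_apply (Ψ : Walker) (i : Fin 2) :
    shiftOp Ψ i = latticeTranslate (![1, -1] i) (Ψ i) := by
  simp [shiftOp]

lemma amplitude_coinOp (C : Matrix (Fin 2) (Fin 2) ℂ) (Ψ : Walker) :
    ∀ᵐ k ∂zone, amplitude (coinOp C Ψ) k = C *ᵥ amplitude Ψ k := by
  have h : ∀ i, ∀ᵐ k ∂zone, amplitude (coinOp C Ψ) k i = (C *ᵥ amplitude Ψ k) i := by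
    intro i
    have h0 := Lp.coeFn_add (C i 0 • synth (Ψ 0)) (C i 1 • synth (Ψ 1))
    have h1 := Lp.coeFn_smul (C i 0) (synth (Ψ 0))
    have h2 := Lp.coeFn_smul (C i 1) (synth (Ψ 1))
    rw [← map_smul, ← map_smul, ← map_add, ← coinOp_apply] at h0
    rw [← map_smul] at h1 h2
    filter_upwards [ae_zone_of_ae_circle h0, ae_zone_of_ae_circle h1, ae_zone_of_ae_circle h2]
      with k e0 e1 e2
    rw [Pi.add_apply, e1, e2] at e0
    simp only [mulVec, dotProduct, Fin.sum_univ_two]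
    exact e0
  filter_upwards [ae_all_iff.mpr h] with k hk
  ext i; exact hk i

/-- The shift at momentum `k`. -/
noncomputable def shiftAt (k : ℝ) : Matrix (Fin 2) (Fin 2) ℂ :=
  diagonal ![Complex.exp (-(Complex.I * k)), Complex.exp (Complex.I * k)]

lemma fourier_neg_coe (a : ℤ) (k : ℝ) :
    fourier a ((-k : ℝ) : AddCircle (2 * π)) = Complex.exp (-(Complex.I * (a * k))) := by
  rw [fourier_coe_apply]
  congr 1
  have : (π : ℂ) ≠ 0 := by exact_mod_cast Real.pi_ne_zero
  push_cast
  field_simp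

lemma amplitude_shiftOp (Ψ : Walker) :
    ∀ᵐ k ∂zone, amplitude (shiftOp Ψ) k = shiftAt k *ᵥ amplitude Ψ k := by
  have h : ∀ i, ∀ᵐ k ∂zone, amplitude (shiftOp Ψ) k i = (shiftAt k *ᵥ amplitude Ψ k) i := by
    intro i
    have h0 := ae_zone_of_ae_circle (synth_latticeTranslate (![1, -1] i) (Ψ i))
    rw [← shiftOp_apply] at h0
    filter_upwards [h0] with k hk
    change amplitude (shiftOp Ψ) k i = fourier _ _ * amplitude Ψ k i at hk
    rw [hk, fourier_neg_coe, shiftAt, mulVec_diagonal]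
    fin_cases i <;> simp
  filter_upwards [ae_all_iff.mpr h] with k hk
  ext i; exact hk i

lemma amplitude_shiftOp_coinOp (C : Matrix (Fin 2) (Fin 2) ℂ) (Ψ : Walker) :
    ∀ᵐ k ∂zone, amplitude (shiftOp (coinOp C Ψ)) k = (shiftAt k * C) *ᵥ amplitude Ψ k := by
  filter_upwards [amplitude_shiftOp (coinOp C Ψ), amplitude_coinOp C Ψ] with k h1 h2
  rw [h1, h2, mulVec_mulVec]

lemma amplitude_evolution (Θ : Params) (Ψ : Walker) :
    ∀ᵐ k ∂zone, amplitude (evolution Θ Ψ) k = stepAt k Θ *ᵥ amplitude Ψ k :=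
  amplitude_shiftOp_coinOp (coin Θ) Ψ

lemma kInt_congr_ae {f g : ℝ → ℂ} (h : f =ᵐ[zone] g) : kInt f = kInt g := by
  rw [kInt_eq, kInt_eq, integral_congr_ae h]

lemma inner_evolution (Θ : Params) (Ψ Φ : Walker) :
    ⟪evolution Θ Ψ, evolution Θ Φ⟫_ℂ = ⟪Ψ, Φ⟫_ℂ := by
  rw [(inner_eq_kInt _ _).2, (inner_eq_kInt Ψ Φ).2]
  refine kInt_congr_ae ?_
  filter_upwards [amplitude_evolution Θ Ψ, amplitude_evolution Θ Φ] with k h1 h2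
  rw [h1, h2, star_mulVec, ← dotProduct_mulVec, mulVec_mulVec, stepAt_conjTranspose_mul,
    one_mulVec]

lemma stateAt_succ (Ψ₀ : Walker) (t : ℕ) (Θ : Params) :
    stateAt Ψ₀ (t + 1) Θ = evolution Θ (stateAt Ψ₀ t Θ) := by
  rw [stateAt, pow_succ']; rfl

lemma norm_stateAt (Ψ₀ : Walker) (t : ℕ) (Θ : Params) : ‖stateAt Ψ₀ t Θ‖ = ‖Ψ₀‖ := by
  induction t with
  | zero => simp [stateAt]
  | succ t ih =>
    rw [← ih, stateAt_succ, @norm_eq_sqrt_re_inner ℂ, inner_evolution, ← @norm_eq_sqrt_re_inner ℂ]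

lemma amplitude_stateAt (Ψ₀ : Walker) (t : ℕ) (Θ : Params) :
    ∀ᵐ k ∂zone, amplitude (stateAt Ψ₀ t Θ) k = (stepAt k Θ ^ t) *ᵥ amplitude Ψ₀ k := by
  induction t with
  | zero => simp [stateAt]
  | succ t ih =>
    filter_upwards [ih, amplitude_evolution Θ (stateAt Ψ₀ t Θ)] with k h1 h2
    rw [stateAt_succ, h2, h1, mulVec_mulVec, pow_succ']

/-! ### Parameter derivatives -/

/-- The partial derivatives of the coin matrix. -/
noncomputable def coinDeriv (Θ : Params) : CoinParam → Matrix (Fin 2) (Fin 2) ℂ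
  | .theta => !![-(Complex.exp (Complex.I * Θ .alpha) * Real.sin (Θ .theta)),
      Complex.exp (Complex.I * Θ .beta) * Real.cos (Θ .theta);
      -(Complex.exp (-(Complex.I * Θ .beta)) * Real.cos (Θ .theta)),
      -(Complex.exp (-(Complex.I * Θ .alpha)) * Real.sin (Θ .theta))]
  | .alpha => !![Complex.I * Complex.exp (Complex.I * Θ .alpha) * Real.cos (Θ .theta), 0;
      0, -(Complex.I * Complex.exp (-(Complex.I * Θ .alpha)) * Real.cos (Θ .theta))]
  | .beta => !![0, Complex.I * Complex.exp (Complex.I * Θ .beta) * Real.sin (Θ .theta);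
      Complex.I * Complex.exp (-(Complex.I * Θ .beta)) * Real.sin (Θ .theta), 0]

lemma hasDerivAt_coin (Θ : Params) (μ : CoinParam) (i j : Fin 2) :
    HasDerivAt (fun s : ℝ => coin (Function.update Θ μ s) i j) (coinDeriv Θ μ i j) (Θ μ) := by
  have hI : ∀ x : ℝ, HasDerivAt (fun s : ℝ => Complex.exp (Complex.I * s))
      (Complex.I * Complex.exp (Complex.I * x)) x := by
    intro x
    have h := ((Complex.ofRealCLM.hasDerivAt (x := x)).const_mul Complex.I).cexp
    simp only [Complex.ofRealCLM_apply, Complex.ofReal_one, mul_one] at h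
    rw [mul_comm] at h
    exact h
  have hI' : ∀ x : ℝ, HasDerivAt (fun s : ℝ => Complex.exp (-(Complex.I * s)))
      (-(Complex.I * Complex.exp (-(Complex.I * x)))) x := by
    intro x
    have h := ((Complex.ofRealCLM.hasDerivAt (x := x)).const_mul Complex.I).neg.cexp
    simp only [Pi.neg_apply, Complex.ofRealCLM_apply, Complex.ofReal_one, mul_one] at h
    rw [mul_comm, neg_mul] at h
    exact h
  have hc : ∀ x : ℝ, HasDerivAt (fun s : ℝ => (Real.cos s : ℂ)) (-(Real.sin x : ℂ)) x := by
    intro x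
    exact_mod_cast (Real.hasDerivAt_cos x).ofReal_comp
  have hs : ∀ x : ℝ, HasDerivAt (fun s : ℝ => (Real.sin s : ℂ)) (Real.cos x : ℂ) x :=
    fun x => (Real.hasDerivAt_sin x).ofReal_comp
  cases μ <;> fin_cases i <;> fin_cases j <;>
    simp only [coin, coinDeriv, Function.update_self, Fin.zero_eta, Fin.mk_one, of_apply,
      cons_val_zero, cons_val_one, cons_val', cons_val_fin_one, ne_eq, reduceCtorEq,
      not_false_eq_true, Function.update_of_ne]
  · simpa using (hc _).const_mul (Complex.exp (Complex.I * Θ .alpha))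
  · exact (hs _).const_mul _
  · exact ((hs _).const_mul _).neg
  · simpa using (hc _).const_mul (Complex.exp (-(Complex.I * Θ .alpha)))
  · exact (hI _).mul_const _
  · exact hasDerivAt_const _ _
  · exact hasDerivAt_const _ _
  · simpa using (hI' _).mul_const (Real.cos (Θ .theta) : ℂ)
  · exact hasDerivAt_const _ _
  · exact (hI _).mul_const _
  · simpa using! ((hI' _).mul_const (Real.sin (Θ .theta) : ℂ)).neg
  · exact hasDerivAt_const _ _

lemma stepAt_eq_shiftAt_mul (k : ℝ) (Θ : Params) : stepAt k Θ = shiftAt k * coin Θ := rfl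

lemma genAt_eq_conjTranspose_mul (k : ℝ) (Θ : Params) (μ : CoinParam) :
    genAt k Θ μ = (stepAt k Θ)ᴴ * (shiftAt k * coinDeriv Θ μ) := by
  rw [genAt]
  congr 1
  ext i j
  simp only [stepAt, shiftAt, diagonal_mul, of_apply]
  exact ((hasDerivAt_coin Θ μ i j).const_mul _).deriv

lemma shiftAt_mul_coinDeriv (k : ℝ) (Θ : Params) (μ : CoinParam) :
    shiftAt k * coinDeriv Θ μ = stepAt k Θ * genAt k Θ μ := by
  rw [genAt_eq_conjTranspose_mul, ← Matrix.mul_assoc (stepAt k Θ), stepAt_mul_conjTranspose,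
    Matrix.one_mul]

lemma shiftAt_conjTranspose_mul (k : ℝ) : (shiftAt k)ᴴ * shiftAt k = 1 := by
  rw [shiftAt, diagonal_conjTranspose, diagonal_mul_diagonal, ← diagonal_one]
  congr 1
  ext i
  fin_cases i <;> simp [← Complex.exp_conj, ← Complex.exp_add]

/-- The shift is unitary and parameter-free, so it cancels. The right side is free of `k`, which
supplies the uniform constant for dominated convergence. -/
lemma genAt_eq (k : ℝ) (Θ : Params) (μ : CoinParam) :
    genAt k Θ μ = (coin Θ)ᴴ * coinDeriv Θ μ := by
  rw [genAt_eq_conjTranspose_mul, stepAt_eq_shiftAt_mul, conjTranspose_mul, Matrix.mul_assoc,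
    ← Matrix.mul_assoc (shiftAt k)ᴴ, shiftAt_conjTranspose_mul, Matrix.one_mul]

lemma conj_exp_I_mul (x : ℝ) :
    (starRingEnd ℂ) (Complex.exp (Complex.I * x)) = Complex.exp (-(Complex.I * x)) := by
  rw [← Complex.exp_conj]; simp

/-- The coin stays in `SU(2)`, so its logarithmic derivative lies in `su(2)`; this is the traceless
half. -/
lemma trace_genAt (k : ℝ) (Θ : Params) (μ : CoinParam) : (genAt k Θ μ).trace = 0 := by
  have ha := Complex.exp_ne_zero (Complex.I * Θ .alpha)
  have hb := Complex.exp_ne_zero (Complex.I * Θ .beta)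
  rw [genAt_eq]
  cases μ <;>
    simp [coin, coinDeriv, trace_fin_two, Matrix.mul_apply, Fin.sum_univ_two, conjTranspose_apply,
      conj_exp_I_mul, Complex.exp_neg, -Complex.ofReal_sin, -Complex.ofReal_cos] <;>
    field_simp <;> ring

lemma genAt_conjTranspose (k : ℝ) (Θ : Params) (μ : CoinParam) :
    (genAt k Θ μ)ᴴ = -genAt k Θ μ := by
  have ha := Complex.exp_ne_zero (Complex.I * Θ .alpha)
  have hb := Complex.exp_ne_zero (Complex.I * Θ .beta)
  rw [genAt_eq]
  ext i j
  cases μ <;> fin_cases i <;> fin_cases j <;>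
    simp [coin, coinDeriv, Matrix.mul_apply, Fin.sum_univ_two, conjTranspose_apply,
      conj_exp_I_mul, Complex.exp_neg, -Complex.ofReal_sin, -Complex.ofReal_cos] <;>
    try field_simp

/-- The partial derivative of the state after `t` steps. -/
noncomputable def stateDeriv (Ψ₀ : Walker) (Θ : Params) (μ : CoinParam) : ℕ → Walker
  | 0 => 0
  | t + 1 => shiftOp (coinOp (coinDeriv Θ μ) (stateAt Ψ₀ t Θ)) +
      evolution Θ (stateDeriv Ψ₀ Θ μ t)

/-- Expanding in matrix units puts all parameter dependence of the step into scalar coefficients of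
fixed bounded operators, so only scalar derivatives are needed. -/
lemma shiftOp_coinOp_eq_sum (C : Matrix (Fin 2) (Fin 2) ℂ) (v : Walker) :
    shiftOp (coinOp C v) =
      ∑ p : Fin 2 × Fin 2, C p.1 p.2 • (shiftOp ∘L coinOp (Matrix.single p.1 p.2 1)) v := by
  simp only [ContinuousLinearMap.comp_apply, ← map_smul, ← map_sum]
  congr 1
  ext i x
  fin_cases i <;>
    simp [coinOp_apply, Fintype.sum_prod_type, Fin.sum_univ_two]

lemma hasDerivAt_smul_clm_apply {E : Type*} [NormedAddCommGroup E] [NormedSpace ℂ E]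
    [NormedSpace ℝ E] [IsScalarTower ℝ ℂ E] {c : ℝ → ℂ} {c' : ℂ} {f : ℝ → E} {f' : E} {x : ℝ}
    (hc : HasDerivAt c c' x) (hf : HasDerivAt f f' x) (A : E →L[ℂ] E) :
    HasDerivAt (fun s => c s • A (f s)) (c x • A f' + c' • A (f x)) x :=
  hc.smul ((A.restrictScalars ℝ).hasFDerivAt.comp_hasDerivAt x hf)

lemma hasDerivAt_stateAt (Ψ₀ : Walker) (Θ : Params) (μ : CoinParam) (t : ℕ) :
    HasDerivAt (fun s : ℝ => stateAt Ψ₀ t (Function.update Θ μ s)) (stateDeriv Ψ₀ Θ μ t) (Θ μ) := by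
  induction t with
  | zero => exact hasDerivAt_const _ _
  | succ t ih =>
    have h : ∀ p : Fin 2 × Fin 2, HasDerivAt
        (fun s : ℝ => coin (Function.update Θ μ s) p.1 p.2 •
          (shiftOp ∘L coinOp (Matrix.single p.1 p.2 1)) (stateAt Ψ₀ t (Function.update Θ μ s)))
        (coin Θ p.1 p.2 • (shiftOp ∘L coinOp (Matrix.single p.1 p.2 1)) (stateDeriv Ψ₀ Θ μ t) +
          coinDeriv Θ μ p.1 p.2 • (shiftOp ∘L coinOp (Matrix.single p.1 p.2 1))
            (stateAt Ψ₀ t Θ)) (Θ μ) := by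
      intro p
      have h := hasDerivAt_smul_clm_apply (hasDerivAt_coin Θ μ p.1 p.2) ih
        (shiftOp ∘L coinOp (Matrix.single p.1 p.2 1))
      rw [Function.update_eq_self] at h
      exact h
    have hs := HasDerivAt.fun_sum (u := Finset.univ) fun p _ => h p
    rw [Finset.sum_add_distrib, ← shiftOp_coinOp_eq_sum, ← shiftOp_coinOp_eq_sum, add_comm] at hs
    refine hs.congr_of_eventuallyEq (Eventually.of_forall fun s => ?_)
    dsimp only
    rw [stateAt_succ, evolution, ContinuousLinearMap.comp_apply, shiftOp_coinOp_eq_sum]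

lemma isBoundedBilinearMap_rankOne :
    IsBoundedBilinearMap ℝ (fun p : Walker × Walker => InnerProductSpace.rankOne ℂ p.1 p.2) where
  add_left x₁ x₂ y := by rw [map_add]; rfl
  smul_left c x y := by
    ext1 z
    change ⟪y, z⟫_ℂ • (c • x) = c • (⟪y, z⟫_ℂ • x)
    rw [smul_comm]
  add_right x y₁ y₂ := map_add _ _ _
  smul_right c x y := by
    have h : ∀ v : Walker, c • v = (c : ℂ) • v := fun v => rfl
    ext1 z
    change ⟪c • y, z⟫_ℂ • x = c • (⟪y, z⟫_ℂ • x)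
    rw [h, h, inner_smul_left, Complex.conj_ofReal, mul_smul]
  bound := ⟨1, one_pos, fun x y => by simp⟩

lemma hasDerivAt_densityAt (Ψ₀ : Walker) (Θ : Params) (μ : CoinParam) (t : ℕ) :
    HasDerivAt (fun s : ℝ => densityAt Ψ₀ t (Function.update Θ μ s))
      (InnerProductSpace.rankOne ℂ (stateAt Ψ₀ t Θ) (stateDeriv Ψ₀ Θ μ t) +
        InnerProductSpace.rankOne ℂ (stateDeriv Ψ₀ Θ μ t) (stateAt Ψ₀ t Θ)) (Θ μ) := by
  have h := hasDerivAt_stateAt Ψ₀ Θ μ t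
  have h2 := (isBoundedBilinearMap_rankOne.hasFDerivAt _).comp_hasDerivAt (Θ μ) (h.prodMk h)
  simp only [Function.update_eq_self] at h2
  exact h2

/-- Derivative of the constant norm of the state. -/
lemma inner_stateDeriv_add (Ψ₀ : Walker) (Θ : Params) (μ : CoinParam) (t : ℕ) :
    ⟪stateAt Ψ₀ t Θ, stateDeriv Ψ₀ Θ μ t⟫_ℂ + ⟪stateDeriv Ψ₀ Θ μ t, stateAt Ψ₀ t Θ⟫_ℂ = 0 := by
  have h := hasDerivAt_stateAt Ψ₀ Θ μ t
  have h2 := h.inner ℂ h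
  have h3 : (fun s : ℝ => ⟪stateAt Ψ₀ t (Function.update Θ μ s),
      stateAt Ψ₀ t (Function.update Θ μ s)⟫_ℂ) = fun _ => ((‖Ψ₀‖ : ℂ)) ^ 2 := by
    ext s
    rw [inner_self_eq_norm_sq_to_K, norm_stateAt]
    rfl
  rw [h3] at h2
  simpa using h2.unique (hasDerivAt_const _ _)

/-! ### Symmetric logarithmic derivatives of the walker -/

section Hilbert

variable {E : Type*} [NormedAddCommGroup E] [InnerProductSpace ℂ E] {ψ χ : E}

open InnerProductSpace in
-- The derivative of `ρ² = ρ` is `{∂ρ, ρ} = ∂ρ`, so `2 ∂ρ` serves as a symmetric logarithmic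
-- derivative of a pure state.
lemma rankOne_deriv_anticommutator (h1 : ⟪ψ, ψ⟫_ℂ = 1) (h0 : ⟪ψ, χ⟫_ℂ + ⟪χ, ψ⟫_ℂ = 0) :
    (1 / 2 : ℂ) • (((2 : ℂ) • (rankOne ℂ ψ χ + rankOne ℂ χ ψ)) * rankOne ℂ ψ ψ +
      rankOne ℂ ψ ψ * ((2 : ℂ) • (rankOne ℂ ψ χ + rankOne ℂ χ ψ))) =
      rankOne ℂ ψ χ + rankOne ℂ χ ψ := by
  have h2 : ⟪χ, ψ⟫_ℂ = -⟪ψ, χ⟫_ℂ := eq_neg_of_add_eq_zero_right h0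
  ext1 z
  simp only [_root_.smul_apply, _root_.add_apply, mul_apply_eq_comp, rankOne_apply,
    inner_smul_right, inner_add_right, h1, h2]
  module

open InnerProductSpace in
-- The equation leaves `L` free away from `ψ`, but evaluating it at `ψ` determines `L ψ`, and
-- nothing else enters `F` and `𝒰`.
lemma apply_eq_of_anticommutator_eq {L : E →L[ℂ] E} (h1 : ⟪ψ, ψ⟫_ℂ = 1)
    (h0 : ⟪ψ, χ⟫_ℂ + ⟪χ, ψ⟫_ℂ = 0)
    (hL : (1 / 2 : ℂ) • (L * rankOne ℂ ψ ψ + rankOne ℂ ψ ψ * L) =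
      rankOne ℂ ψ χ + rankOne ℂ χ ψ) :
    L ψ = (2 : ℂ) • (χ - ⟪ψ, χ⟫_ℂ • ψ) := by
  have h := congrArg (fun T : E →L[ℂ] E => T ψ) hL
  simp only [_root_.smul_apply, _root_.add_apply, mul_apply_eq_comp, rankOne_apply, h1,
    one_smul] at h
  have h2 : ⟪χ, ψ⟫_ℂ = -⟪ψ, χ⟫_ℂ := eq_neg_of_add_eq_zero_right h0
  -- Pairing with `ψ` makes the two terms on the left equal, while those on the right cancel by
  -- `h0`.
  have h3 : ⟪ψ, L ψ⟫_ℂ = 0 := by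
    have h4 := congrArg (fun v => ⟪ψ, v⟫_ℂ) h
    simp only [inner_smul_right, inner_add_right, h1, h2] at h4
    linear_combination h4
  rw [h3, h2] at h
  have h5 : L ψ = (2 : ℂ) • ((1 / 2 : ℂ) • (L ψ + (0 : ℂ) • ψ)) := by module
  rw [h5, h]
  module

end Hilbert

lemma inner_stateAt_self {Ψ₀ : Walker} (hΨ : ‖Ψ₀‖ = 1) (t : ℕ) (Θ : Params) :
    ⟪stateAt Ψ₀ t Θ, stateAt Ψ₀ t Θ⟫_ℂ = 1 := by
  rw [inner_self_eq_norm_sq_to_K, norm_stateAt, hΨ]; simp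

lemma isSLD_two_smul_deriv {Ψ₀ : Walker} (hΨ : ‖Ψ₀‖ = 1) (Θ : Params) (μ : CoinParam) (t : ℕ) :
    IsSLD (densityAt Ψ₀ t) Θ μ ((2 : ℂ) •
      (InnerProductSpace.rankOne ℂ (stateAt Ψ₀ t Θ) (stateDeriv Ψ₀ Θ μ t) +
        InnerProductSpace.rankOne ℂ (stateDeriv Ψ₀ Θ μ t) (stateAt Ψ₀ t Θ))) := by
  constructor
  · rw [ContinuousLinearMap.isSelfAdjoint_iff', map_smulₛₗ, map_add,
      InnerProductSpace.adjoint_rankOne, InnerProductSpace.adjoint_rankOne, add_comm, map_ofNat]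
  · have h := rankOne_deriv_anticommutator (inner_stateAt_self hΨ t Θ)
      (inner_stateDeriv_add Ψ₀ Θ μ t)
    rw [densityAt, h]
    exact hasDerivAt_densityAt Ψ₀ Θ μ t

lemma IsSLD.apply_stateAt {Ψ₀ : Walker} (hΨ : ‖Ψ₀‖ = 1) {Θ : Params} {μ : CoinParam} {t : ℕ}
    {L : Walker →L[ℂ] Walker} (hL : IsSLD (densityAt Ψ₀ t) Θ μ L) :
    L (stateAt Ψ₀ t Θ) = (2 : ℂ) • (stateDeriv Ψ₀ Θ μ t -
      ⟪stateAt Ψ₀ t Θ, stateDeriv Ψ₀ Θ μ t⟫_ℂ • stateAt Ψ₀ t Θ) :=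
  apply_eq_of_anticommutator_eq (inner_stateAt_self hΨ t Θ) (inner_stateDeriv_add Ψ₀ Θ μ t)
    (hL.2.unique (hasDerivAt_densityAt Ψ₀ Θ μ t))

lemma hasSum_inner_ket (v w : Walker) :
    HasSum (fun p : ℤ × Fin 2 => ⟪v, ket p.1 p.2⟫_ℂ * ⟪ket p.1 p.2, w⟫_ℂ) ⟪v, w⟫_ℂ := by
  have hket : ∀ (x : ℤ) (j : Fin 2) (w : Walker), ⟪ket x j, w⟫_ℂ = w j x := by
    intro x j w
    rw [ket, PiLp.inner_apply, Finset.sum_eq_single j]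
    · simp [lp.inner_single_left]
    · intro i _ hi
      simp [hi]
    · simp
  have hj : ∀ j : Fin 2, HasSum (fun p : ℤ × Fin 2 => if p.2 = j then
      ⟪v, ket p.1 p.2⟫_ℂ * ⟪ket p.1 p.2, w⟫_ℂ else 0) ⟪v j, w j⟫_ℂ := by
    intro j
    have hinj : Function.Injective (fun x : ℤ => (x, j)) := fun a b h => (Prod.mk.inj h).1
    refine (hinj.hasSum_iff ?_).mp ?_
    · rintro ⟨x, i⟩ hx
      refine if_neg ?_
      rintro rfl
      exact hx ⟨x, rfl⟩
    · have h := lp.hasSum_inner (𝕜 := ℂ) (v j) (w j)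
      convert! h using 1
      ext x
      simp only [Function.comp_apply, if_true]
      rw [← inner_conj_symm v, hket, hket, RCLike.inner_apply, mul_comm]
  have h := hasSum_sum (s := Finset.univ) fun j _ => hj j
  rw [PiLp.inner_apply]
  convert! h using 1
  ext p
  simp

lemma opTrace_rankOne_mul (ψ : Walker) (T : Walker →L[ℂ] Walker) :
    opTrace (InnerProductSpace.rankOne ℂ ψ ψ * T) = ⟪ψ, T ψ⟫_ℂ := by
  rw [opTrace, ← ContinuousLinearMap.adjoint_inner_left, ← (hasSum_inner_ket _ ψ).tsum_eq]
  refine tsum_congr fun p => ?_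
  rw [mul_apply_eq_comp, InnerProductSpace.rankOne_apply, inner_smul_right,
    ContinuousLinearMap.adjoint_inner_left]

/-- `4 (⟨∂_μ ψ|∂_ν ψ⟩ - ⟨∂_μ ψ|ψ⟩⟨ψ|∂_ν ψ⟩)`. -/
noncomputable def geometricTensor (Ψ₀ : Walker) (Θ : Params) (t : ℕ) (μ ν : CoinParam) : ℂ :=
  4 * (⟪stateDeriv Ψ₀ Θ μ t, stateDeriv Ψ₀ Θ ν t⟫_ℂ -
    ⟪stateDeriv Ψ₀ Θ μ t, stateAt Ψ₀ t Θ⟫_ℂ * ⟪stateAt Ψ₀ t Θ, stateDeriv Ψ₀ Θ ν t⟫_ℂ)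

lemma inner_SLD_apply_SLD {Ψ₀ : Walker} (hΨ : ‖Ψ₀‖ = 1) {Θ : Params} {μ ν : CoinParam} {t : ℕ}
    {L M : Walker →L[ℂ] Walker} (hL : IsSLD (densityAt Ψ₀ t) Θ μ L)
    (hM : IsSLD (densityAt Ψ₀ t) Θ ν M) :
    ⟪stateAt Ψ₀ t Θ, L (M (stateAt Ψ₀ t Θ))⟫_ℂ = geometricTensor Ψ₀ Θ t μ ν := by
  have h1 := inner_stateAt_self hΨ t Θ
  rw [← ContinuousLinearMap.adjoint_inner_left, ← ContinuousLinearMap.star_eq_adjoint, hL.1.star_eq,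
    hL.apply_stateAt hΨ, hM.apply_stateAt hΨ, geometricTensor]
  simp only [inner_smul_left, inner_smul_right, inner_sub_left, inner_sub_right, h1,
    inner_conj_symm, map_ofNat]
  ring

lemma qfi_eq {Ψ₀ : Walker} (hΨ : ‖Ψ₀‖ = 1) {Θ : Params} {μ ν : CoinParam} {t : ℕ}
    {L M : Walker →L[ℂ] Walker} (hL : IsSLD (densityAt Ψ₀ t) Θ μ L)
    (hM : IsSLD (densityAt Ψ₀ t) Θ ν M) :
    qfi (densityAt Ψ₀ t Θ) L M =
      1 / 2 * (geometricTensor Ψ₀ Θ t μ ν + geometricTensor Ψ₀ Θ t ν μ) := by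
  rw [qfi, densityAt, opTrace_rankOne_mul, ← inner_SLD_apply_SLD hΨ hL hM,
    ← inner_SLD_apply_SLD hΨ hM hL, ← inner_add_right]
  rfl

lemma uhlmann_eq {Ψ₀ : Walker} (hΨ : ‖Ψ₀‖ = 1) {Θ : Params} {μ ν : CoinParam} {t : ℕ}
    {L M : Walker →L[ℂ] Walker} (hL : IsSLD (densityAt Ψ₀ t) Θ μ L)
    (hM : IsSLD (densityAt Ψ₀ t) Θ ν M) :
    uhlmann (densityAt Ψ₀ t Θ) L M =
      -(Complex.I / 2) * (geometricTensor Ψ₀ Θ t μ ν - geometricTensor Ψ₀ Θ t ν μ) := by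
  rw [uhlmann, densityAt, opTrace_rankOne_mul, ← inner_SLD_apply_SLD hΨ hL hM,
    ← inner_SLD_apply_SLD hΨ hM hL, ← inner_sub_right]
  rfl

/-! ### Momentum-space form of the derivative and the long-time limit -/

lemma amplitude_zero : ∀ᵐ k ∂zone, amplitude 0 k = 0 := by
  have h := amplitude_coinOp 0 0
  rw [map_zero] at h
  filter_upwards [h] with k hk
  rw [hk, zero_mulVec]

/-- This is the Leibniz recursion that defines `stateDeriv`, read at one momentum. -/
lemma orbitSum_succ (k : ℝ) (Θ : Params) (O : Matrix (Fin 2) (Fin 2) ℂ) (t : ℕ) :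
    stepAt k Θ ^ (t + 1) * orbitSum k Θ O (t + 1) =
      stepAt k Θ * O * stepAt k Θ ^ t + stepAt k Θ * (stepAt k Θ ^ t * orbitSum k Θ O t) := by
  have hc : Commute (stepAt k Θ) (stepAt k Θ)ᴴ := by
    rw [Commute, SemiconjBy, stepAt_conjTranspose_mul, stepAt_mul_conjTranspose]
  have h : stepAt k Θ ^ t * (stepAt k Θ)ᴴ ^ t = 1 := by
    rw [← hc.mul_pow, stepAt_mul_conjTranspose, one_pow]
  rw [orbitSum, Finset.sum_range_succ, ← orbitSum, mul_add, add_comm, pow_succ']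
  simp only [Matrix.mul_assoc]
  rw [← Matrix.mul_assoc (stepAt k Θ ^ t), h, Matrix.one_mul]

lemma amplitude_stateDeriv (Ψ₀ : Walker) (Θ : Params) (μ : CoinParam) (t : ℕ) :
    ∀ᵐ k ∂zone, amplitude (stateDeriv Ψ₀ Θ μ t) k =
      (stepAt k Θ ^ t * orbitSum k Θ (genAt k Θ μ) t) *ᵥ amplitude Ψ₀ k := by
  induction t with
  | zero =>
    filter_upwards [amplitude_zero] with k hk
    simpa [stateDeriv, orbitSum] using hk
  | succ t ih =>
    filter_upwards [ih, amplitude_stateAt Ψ₀ t Θ,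
      amplitude_add (shiftOp (coinOp (coinDeriv Θ μ) (stateAt Ψ₀ t Θ)))
        (evolution Θ (stateDeriv Ψ₀ Θ μ t)),
      amplitude_shiftOp_coinOp (coinDeriv Θ μ) (stateAt Ψ₀ t Θ),
      amplitude_evolution Θ (stateDeriv Ψ₀ Θ μ t)] with k h1 h2 h3 h4 h5
    rw [stateDeriv, h3, h4, h5, h1, h2, mulVec_mulVec, mulVec_mulVec, ← add_mulVec,
      shiftAt_mul_coinDeriv, orbitSum_succ]

section Norm

open scoped Matrix.Norms.L2Operator

lemma stepAt_pow_mem_unitary (k : ℝ) (Θ : Params) (t : ℕ) :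
    stepAt k Θ ^ t ∈ unitary (Matrix (Fin 2) (Fin 2) ℂ) :=
  pow_mem (Unitary.mem_iff.mpr ⟨stepAt_conjTranspose_mul k Θ, stepAt_mul_conjTranspose k Θ⟩) t

lemma norm_conj_stepAt_pow (k : ℝ) (Θ : Params) (R : Matrix (Fin 2) (Fin 2) ℂ) (t : ℕ) :
    ‖(stepAt k Θ)ᴴ ^ t * R * stepAt k Θ ^ t‖ = ‖R‖ := by
  rw [CStarRing.norm_mul_mem_unitary _ (stepAt_pow_mem_unitary k Θ t), ← conjTranspose_pow]
  exact CStarRing.norm_mem_unitary_mul _ (Unitary.star_mem (stepAt_pow_mem_unitary k Θ t))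

lemma norm_orbitSum_le (k : ℝ) (Θ : Params) (O : Matrix (Fin 2) (Fin 2) ℂ) (t : ℕ) :
    ‖(t : ℂ)⁻¹ • orbitSum k Θ O t‖ ≤ ‖O‖ := by
  have h : ‖orbitSum k Θ O t‖ ≤ t * ‖O‖ := by
    refine (norm_sum_le _ _).trans ?_
    simp [norm_conj_stepAt_pow]
  rw [norm_smul, norm_inv, Complex.norm_natCast]
  -- At `t = 0` the convention `0⁻¹ = 0` makes the bound trivial, so it holds for all `t`.
  rcases Nat.eq_zero_or_pos t with rfl | ht
  · simp
  · have ht' : (0 : ℝ) < t := by exact_mod_cast ht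
    rw [inv_mul_le_iff₀ ht']
    exact h

lemma tendsto_orbitSum (k : ℝ) {Θ : Params} (hθ : Real.sin (Θ .theta) ≠ 0)
    {O : Matrix (Fin 2) (Fin 2) ℂ} (hO : O.trace = 0) :
    Tendsto (fun t : ℕ => (t : ℂ)⁻¹ • orbitSum k Θ O t) atTop (𝓝 (commutantPart k Θ O)) := by
  obtain ⟨R, hR⟩ := orbitSum_sub k hθ hO
  rw [tendsto_iff_norm_sub_tendsto_zero]
  have hlim : Tendsto (fun t : ℕ => (2 * ‖R‖) / (t : ℝ)) atTop (𝓝 0) :=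
    tendsto_const_div_atTop_nhds_zero_nat _
  refine squeeze_zero' (Eventually.of_forall fun _ => norm_nonneg _) ?_ hlim
  filter_upwards [eventually_gt_atTop 0] with t ht
  have ht' : (t : ℂ) ≠ 0 := by exact_mod_cast ht.ne'
  have h1 : (t : ℂ)⁻¹ • orbitSum k Θ O t - commutantPart k Θ O =
      (t : ℂ)⁻¹ • (R - (stepAt k Θ)ᴴ ^ t * R * stepAt k Θ ^ t) := by
    rw [← hR, smul_sub, inv_smul_smul₀ ht']
  rw [h1, norm_smul, norm_inv, Complex.norm_natCast, div_eq_inv_mul]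
  gcongr
  refine (norm_sub_le _ _).trans ?_
  rw [norm_conj_stepAt_pow, two_mul]

lemma norm_star_dotProduct_mulVec_le (M : Matrix (Fin 2) (Fin 2) ℂ) (v : Fin 2 → ℂ) :
    ‖star v ⬝ᵥ (M *ᵥ v)‖ ≤ ‖M‖ * ‖star v ⬝ᵥ v‖ := by
  have h : ∀ w : Fin 2 → ℂ, star v ⬝ᵥ w = ⟪WithLp.toLp 2 v, WithLp.toLp 2 w⟫_ℂ := by
    intro w
    rw [EuclideanSpace.inner_toLp_toLp, dotProduct_comm]
  rw [h, h, inner_self_eq_norm_sq_to_K]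
  refine (norm_inner_le_norm _ _).trans ?_
  have h2 := l2_opNorm_mulVec M (WithLp.toLp 2 v)
  have h3 : ‖((‖WithLp.toLp 2 v‖ : ℂ)) ^ 2‖ = ‖WithLp.toLp 2 v‖ ^ 2 := by simp
  refine (mul_le_mul_of_nonneg_left h2 (norm_nonneg _)).trans (le_of_eq ?_)
  refine Eq.trans ?_ (congrArg (‖M‖ * ·) h3.symm)
  ring

/-- Dominated convergence for quadratic forms in the initial amplitude. -/
lemma tendsto_kInt_of_tendsto (Ψ₀ : Walker) {F : ℕ → ℝ → ℂ}
    {M : ℕ → ℝ → Matrix (Fin 2) (Fin 2) ℂ} {M' : ℝ → Matrix (Fin 2) (Fin 2) ℂ} {C : ℝ}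
    (hF : ∀ t, AEStronglyMeasurable (F t) zone)
    (hFM : ∀ t, ∀ᵐ k ∂zone, F t k = star (amplitude Ψ₀ k) ⬝ᵥ (M t k *ᵥ amplitude Ψ₀ k))
    (hC : ∀ t k, ‖M t k‖ ≤ C) (hM : ∀ k, Tendsto (fun t => M t k) atTop (𝓝 (M' k))) :
    Tendsto (fun t => kInt (F t)) atTop
      (𝓝 (kInt fun k => star (amplitude Ψ₀ k) ⬝ᵥ (M' k *ᵥ amplitude Ψ₀ k))) := by
  simp_rw [kInt_eq]
  refine Tendsto.const_mul _ (tendsto_integral_of_dominated_convergence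
    (fun k => C * ‖star (amplitude Ψ₀ k) ⬝ᵥ amplitude Ψ₀ k‖) hF
    ((inner_eq_kInt Ψ₀ Ψ₀).1.norm.const_mul C) (fun t => ?_) ?_)
  · filter_upwards [hFM t] with k hk
    rw [hk]
    exact (norm_star_dotProduct_mulVec_le _ _).trans
      (mul_le_mul_of_nonneg_right (hC t k) (norm_nonneg _))
  · filter_upwards [ae_all_iff.mpr hFM] with k hk
    simp_rw [hk]
    have hcont : Continuous fun M : Matrix (Fin 2) (Fin 2) ℂ =>
        star (amplitude Ψ₀ k) ⬝ᵥ (M *ᵥ amplitude Ψ₀ k) := by fun_prop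
    exact (hcont.tendsto _).comp (hM k)

lemma tendsto_inner_stateDeriv {Θ : Params} (hθ : Real.sin (Θ .theta) ≠ 0) (Ψ₀ : Walker)
    (μ ν : CoinParam) :
    Tendsto (fun t : ℕ => ⟪stateDeriv Ψ₀ Θ μ t, stateDeriv Ψ₀ Θ ν t⟫_ℂ / (t : ℂ) ^ 2) atTop
      (𝓝 (kInt fun k => star (amplitude Ψ₀ k) ⬝ᵥ
        (((commutantPart k Θ (genAt k Θ μ))ᴴ * commutantPart k Θ (genAt k Θ ν)) *ᵥ
          amplitude Ψ₀ k))) := by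
  have hk : ∀ t : ℕ, ⟪stateDeriv Ψ₀ Θ μ t, stateDeriv Ψ₀ Θ ν t⟫_ℂ / (t : ℂ) ^ 2 =
      kInt fun k => ((t : ℂ) ^ 2)⁻¹ *
        (star (amplitude (stateDeriv Ψ₀ Θ μ t) k) ⬝ᵥ amplitude (stateDeriv Ψ₀ Θ ν t) k) := by
    intro t
    rw [(inner_eq_kInt _ _).2, kInt_eq, kInt_eq, integral_const_mul]
    ring
  simp_rw [hk]
  refine tendsto_kInt_of_tendsto Ψ₀
    (M := fun t k => ((t : ℂ)⁻¹ • orbitSum k Θ (genAt k Θ μ) t)ᴴ *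
      ((t : ℂ)⁻¹ • orbitSum k Θ (genAt k Θ ν) t))
    (C := ‖(coin Θ)ᴴ * coinDeriv Θ μ‖ * ‖(coin Θ)ᴴ * coinDeriv Θ ν‖)
    -- Measurability comes from the integrable inner product of amplitudes, so the matrices need not
    -- be shown measurable in `k`.
    (fun t => ((inner_eq_kInt _ _).1.const_mul _).aestronglyMeasurable) (fun t => ?_)
    (fun t k => ?_) (fun k => ?_)
  · filter_upwards [amplitude_stateDeriv Ψ₀ Θ μ t, amplitude_stateDeriv Ψ₀ Θ ν t] with k h1 h2
    have hu : (stepAt k Θ ^ t)ᴴ * stepAt k Θ ^ t = 1 :=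
      Unitary.star_mul_self_of_mem (stepAt_pow_mem_unitary k Θ t)
    rw [h1, h2, star_mulVec, ← dotProduct_mulVec, mulVec_mulVec, conjTranspose_mul,
      Matrix.mul_assoc, ← Matrix.mul_assoc (stepAt k Θ ^ t)ᴴ, hu, Matrix.one_mul,
      conjTranspose_smul, Matrix.smul_mul, Matrix.mul_smul, smul_smul, smul_mulVec,
      dotProduct_smul, smul_eq_mul]
    simp [sq]
  · refine (norm_mul_le _ _).trans ?_
    rw [l2_opNorm_conjTranspose]
    have h1 := norm_orbitSum_le k Θ (genAt k Θ μ) t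
    have h2 := norm_orbitSum_le k Θ (genAt k Θ ν) t
    nth_rw 2 [genAt_eq] at h1 h2
    gcongr
  · have h1 := tendsto_orbitSum k hθ (trace_genAt k Θ μ)
    have h2 := tendsto_orbitSum k hθ (trace_genAt k Θ ν)
    exact ((continuous_id.matrix_conjTranspose.tendsto _).comp h1).mul h2

lemma tendsto_inner_stateAt_stateDeriv {Θ : Params} (hθ : Real.sin (Θ .theta) ≠ 0) (Ψ₀ : Walker)
    (μ : CoinParam) :
    Tendsto (fun t : ℕ => ⟪stateAt Ψ₀ t Θ, stateDeriv Ψ₀ Θ μ t⟫_ℂ / (t : ℂ)) atTop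
      (𝓝 (kInt fun k => star (amplitude Ψ₀ k) ⬝ᵥ
        (commutantPart k Θ (genAt k Θ μ) *ᵥ amplitude Ψ₀ k))) := by
  have hk : ∀ t : ℕ, ⟪stateAt Ψ₀ t Θ, stateDeriv Ψ₀ Θ μ t⟫_ℂ / (t : ℂ) =
      kInt fun k => (t : ℂ)⁻¹ *
        (star (amplitude (stateAt Ψ₀ t Θ) k) ⬝ᵥ amplitude (stateDeriv Ψ₀ Θ μ t) k) := by
    intro t
    rw [(inner_eq_kInt _ _).2, kInt_eq, kInt_eq, integral_const_mul]
    ring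
  simp_rw [hk]
  refine tendsto_kInt_of_tendsto Ψ₀
    (M := fun t k => (t : ℂ)⁻¹ • orbitSum k Θ (genAt k Θ μ) t)
    (C := ‖(coin Θ)ᴴ * coinDeriv Θ μ‖)
    (fun t => ((inner_eq_kInt _ _).1.const_mul _).aestronglyMeasurable) (fun t => ?_)
    (fun t k => ?_) (fun k => tendsto_orbitSum k hθ (trace_genAt k Θ μ))
  · filter_upwards [amplitude_stateAt Ψ₀ t Θ, amplitude_stateDeriv Ψ₀ Θ μ t] with k h1 h2
    have hu : (stepAt k Θ ^ t)ᴴ * stepAt k Θ ^ t = 1 :=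
      Unitary.star_mul_self_of_mem (stepAt_pow_mem_unitary k Θ t)
    rw [h1, h2, star_mulVec, ← dotProduct_mulVec, mulVec_mulVec, ← Matrix.mul_assoc, hu,
      Matrix.one_mul, smul_mulVec, dotProduct_smul, smul_eq_mul]
  · have h1 := norm_orbitSum_le k Θ (genAt k Θ μ) t
    nth_rw 2 [genAt_eq] at h1
    exact h1

end Norm

/-! ### Evaluation of the limits -/

lemma star_dotProduct_mulVec_eq_trace (Ψ₀ : Walker) (k : ℝ) (M : Matrix (Fin 2) (Fin 2) ℂ) :
    star (amplitude Ψ₀ k) ⬝ᵥ (M *ᵥ amplitude Ψ₀ k) = (rhoZero Ψ₀ k * M).trace := by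
  rw [rhoZero, trace_mul_comm, mul_vecMulVec, trace_vecMulVec, dotProduct_comm]

lemma rhoZero_conjTranspose (Ψ₀ : Walker) (k : ℝ) : (rhoZero Ψ₀ k)ᴴ = rhoZero Ψ₀ k := by
  rw [rhoZero, conjTranspose_vecMulVec, star_star]

/-- Both factors are skew-adjoint, so the two signs cancel and the trace is real. With the
self-adjoint `ϱ₀` one sign survives and the trace is imaginary. -/
lemma star_trace_genAt_mul_skewPart (k : ℝ) (Θ : Params) (μ : CoinParam) :
    star (genAt k Θ μ * skewPart k Θ).trace = (genAt k Θ μ * skewPart k Θ).trace := by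
  rw [← trace_conjTranspose, conjTranspose_mul, genAt_conjTranspose, skewPart_conjTranspose,
    neg_mul_neg, trace_mul_comm]

lemma star_trace_rhoZero_mul_skewPart (Ψ₀ : Walker) (k : ℝ) (Θ : Params) :
    star (rhoZero Ψ₀ k * skewPart k Θ).trace = -(rhoZero Ψ₀ k * skewPart k Θ).trace := by
  rw [← trace_conjTranspose, conjTranspose_mul, rhoZero_conjTranspose, skewPart_conjTranspose,
    neg_mul, trace_neg, trace_mul_comm]

lemma trace_rhoZero_mul_commutantPart {Θ : Params} (hθ : Real.sin (Θ .theta) ≠ 0) (Ψ₀ : Walker)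
    (k : ℝ) (μ : CoinParam) :
    (rhoZero Ψ₀ k * commutantPart k Θ (genAt k Θ μ)).trace =
      1 / 2 * form k Θ (rhoZero Ψ₀ k) (genAt k Θ μ) := by
  rw [form_eq k hθ, star_trace_rhoZero_mul_skewPart, trace_genAt, commutantPart, Matrix.mul_smul,
    trace_smul, smul_eq_mul]
  ring

lemma form_genAt_rhoZero {Θ : Params} (hθ : Real.sin (Θ .theta) ≠ 0) (Ψ₀ : Walker)
    (k : ℝ) (μ : CoinParam) :
    form k Θ (genAt k Θ μ) (rhoZero Ψ₀ k) = -form k Θ (rhoZero Ψ₀ k) (genAt k Θ μ) := by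
  rw [form_eq k hθ, form_eq k hθ, star_trace_rhoZero_mul_skewPart, star_trace_genAt_mul_skewPart,
    trace_genAt, star_zero]
  ring

/-- Commutant parts are multiples of `W`, and `W²` is scalar, so `ϱ₀` enters only through its trace.
The `1/4` cancels the factor `4` in `geometricTensor`. -/
lemma trace_rhoZero_mul_commutantPart_mul {Θ : Params} (hθ : Real.sin (Θ .theta) ≠ 0)
    (Ψ₀ : Walker) (k : ℝ) (μ ν : CoinParam) :
    (rhoZero Ψ₀ k * ((commutantPart k Θ (genAt k Θ μ))ᴴ *
      commutantPart k Θ (genAt k Θ ν))).trace =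
      1 / 4 * ((rhoZero Ψ₀ k).trace * form k Θ (genAt k Θ μ) (genAt k Θ ν)) := by
  have hQ : (axisSq k Θ : ℂ) ≠ 0 := by exact_mod_cast (axisSq_pos hθ k).ne'
  have hs : star (-(genAt k Θ μ * skewPart k Θ).trace / (8 * axisSq k Θ) : ℂ) =
      -(genAt k Θ μ * skewPart k Θ).trace / (8 * axisSq k Θ) := by
    rw [star_div₀, star_neg, star_trace_genAt_mul_skewPart]
    simp
  rw [form_eq k hθ, star_trace_genAt_mul_skewPart, trace_genAt, trace_genAt, star_zero,
    commutantPart, commutantPart, conjTranspose_smul, hs, skewPart_conjTranspose]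
  simp only [Matrix.smul_mul, Matrix.mul_smul, Matrix.neg_mul, Matrix.mul_neg, skewPart_mul_self,
    Matrix.mul_one, trace_smul, trace_neg, smul_eq_mul]
  field_simp
  ring

lemma form_genAt_comm {Θ : Params} (hθ : Real.sin (Θ .theta) ≠ 0) (k : ℝ) (μ ν : CoinParam) :
    form k Θ (genAt k Θ μ) (genAt k Θ ν) = form k Θ (genAt k Θ ν) (genAt k Θ μ) := by
  rw [form_eq k hθ, form_eq k hθ, star_trace_genAt_mul_skewPart, star_trace_genAt_mul_skewPart,
    trace_genAt, trace_genAt]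
  ring

lemma kInt_const_mul (c : ℂ) (f : ℝ → ℂ) : kInt (fun k => c * f k) = c * kInt f := by
  rw [kInt_eq, kInt_eq, integral_const_mul]
  ring

/-- The limit of `F_{μν}(t) / t²`. -/
noncomputable def asymptoticTensor (Ψ₀ : Walker) (Θ : Params) (μ ν : CoinParam) : ℂ :=
  kInt (fun k => (rhoZero Ψ₀ k).trace * form k Θ (genAt k Θ μ) (genAt k Θ ν)) -
    kInt (fun k => form k Θ (genAt k Θ μ) (rhoZero Ψ₀ k)) *
      kInt (fun k => form k Θ (rhoZero Ψ₀ k) (genAt k Θ ν))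

lemma asymptoticTensor_eq {Θ : Params} (hθ : Real.sin (Θ .theta) ≠ 0) (Ψ₀ : Walker)
    (μ ν : CoinParam) :
    asymptoticTensor Ψ₀ Θ μ ν =
      kInt (fun k => (rhoZero Ψ₀ k).trace * form k Θ (genAt k Θ μ) (genAt k Θ ν)) +
        kInt (fun k => form k Θ (rhoZero Ψ₀ k) (genAt k Θ μ)) *
          kInt (fun k => form k Θ (rhoZero Ψ₀ k) (genAt k Θ ν)) := by
  simp_rw [asymptoticTensor, form_genAt_rhoZero hθ, ← neg_one_mul (form _ _ _ _), kInt_const_mul]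
  ring

lemma asymptoticTensor_comm {Θ : Params} (hθ : Real.sin (Θ .theta) ≠ 0) (Ψ₀ : Walker)
    (μ ν : CoinParam) : asymptoticTensor Ψ₀ Θ μ ν = asymptoticTensor Ψ₀ Θ ν μ := by
  simp_rw [asymptoticTensor_eq hθ, form_genAt_comm hθ _ μ ν]
  ring

lemma tendsto_geometricTensor {Θ : Params} (hθ : Real.sin (Θ .theta) ≠ 0) (Ψ₀ : Walker)
    (μ ν : CoinParam) :
    Tendsto (fun t : ℕ => geometricTensor Ψ₀ Θ t μ ν / (t : ℂ) ^ 2) atTop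
      (𝓝 (asymptoticTensor Ψ₀ Θ μ ν)) := by
  have h1 := tendsto_inner_stateDeriv hθ Ψ₀ μ ν
  have h2 := tendsto_inner_stateAt_stateDeriv hθ Ψ₀ μ
  have h3 := tendsto_inner_stateAt_stateDeriv hθ Ψ₀ ν
  simp_rw [star_dotProduct_mulVec_eq_trace, trace_rhoZero_mul_commutantPart hθ,
    trace_rhoZero_mul_commutantPart_mul hθ, kInt_const_mul] at h1 h2 h3
  have h := (h1.add (h2.mul h3)).const_mul 4
  convert! h using 1
  · ext t
    -- The overlap `⟨∂_μψ, ψ⟩` is `-⟨ψ, ∂_μψ⟩`, so the subtracted product becomes the added product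
    -- of the limits `h2` and `h3`.
    rw [geometricTensor, eq_neg_of_add_eq_zero_right (inner_stateDeriv_add Ψ₀ Θ μ t)]
    ring
  · rw [asymptoticTensor_eq hθ]
    ring_nf

end QWalk

theorem theorem1 (Θ : QWalk.Params) (hθ : Real.sin (Θ .theta) ≠ 0)
    (Ψ₀ : QWalk.Walker) (hΨ : ‖Ψ₀‖ = 1) :
    -- `A_k^𝟙` is the orthogonal projector onto the eigenvalue-1 eigenspace of the superoperator
    (∀ k : ℝ, (QWalk.projOne k Θ).IsHermitian ∧
      QWalk.projOne k Θ * QWalk.projOne k Θ = QWalk.projOne k Θ ∧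
      ∀ v : Fin 4 → ℂ,
        QWalk.projOne k Θ *ᵥ v = v ↔ QWalk.superop k Θ *ᵥ v = v) ∧
    -- symmetric logarithmic derivatives exist
    (∀ (t : ℕ) (μ : QWalk.CoinParam), ∃ L : QWalk.Walker →L[ℂ] QWalk.Walker,
      QWalk.IsSLD (QWalk.densityAt Ψ₀ t) Θ μ L) ∧
    -- the asymptotics, for every choice of symmetric logarithmic derivatives
    ∀ L : ℕ → QWalk.CoinParam → QWalk.Walker →L[ℂ] QWalk.Walker,
      (∀ t μ, QWalk.IsSLD (QWalk.densityAt Ψ₀ t) Θ μ (L t μ)) →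
      ∀ μ ν : QWalk.CoinParam,
        -- arbitrary initial state
        Tendsto
          (fun t : ℕ => QWalk.qfi (QWalk.densityAt Ψ₀ t Θ) (L t μ) (L t ν) / (t : ℂ) ^ 2) atTop
          (𝓝 (QWalk.kInt (fun k => (QWalk.rhoZero Ψ₀ k).trace *
                QWalk.form k Θ (QWalk.genAt k Θ μ) (QWalk.genAt k Θ ν)) -
              QWalk.kInt (fun k => QWalk.form k Θ (QWalk.genAt k Θ μ) (QWalk.rhoZero Ψ₀ k)) *
              QWalk.kInt (fun k => QWalk.form k Θ (QWalk.rhoZero Ψ₀ k) (QWalk.genAt k Θ ν)))) ∧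
        -- initial state for which `ϱ₀` has trace one at almost every `k`
        ((∀ᵐ k ∂(volume.restrict (Set.Ioc (-π) π)), (QWalk.rhoZero Ψ₀ k).trace = 1) →
          Tendsto
            (fun t : ℕ => QWalk.qfi (QWalk.densityAt Ψ₀ t Θ) (L t μ) (L t ν) / (t : ℂ) ^ 2) atTop
            (𝓝 (QWalk.kInt (fun k => QWalk.form k Θ (QWalk.genAt k Θ μ) (QWalk.genAt k Θ ν)) -
                QWalk.kInt (fun k => QWalk.form k Θ (QWalk.genAt k Θ μ) (QWalk.rhoZero Ψ₀ k)) *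
                QWalk.kInt (fun k =>
                  QWalk.form k Θ (QWalk.rhoZero Ψ₀ k) (QWalk.genAt k Θ ν))))) ∧
        Tendsto
          (fun t : ℕ => QWalk.uhlmann (QWalk.densityAt Ψ₀ t Θ) (L t μ) (L t ν) / (t : ℂ) ^ 2) atTop
          (𝓝 0) := by
  refine ⟨fun k => ⟨QWalk.projOne_isHermitian k hθ, QWalk.projOne_mul_self k hθ,
    QWalk.projOne_mulVec_eq_iff k hθ⟩, fun t μ => ⟨_, QWalk.isSLD_two_smul_deriv hΨ Θ μ t⟩, ?_⟩
  intro L hL μ ν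
  have h1 := QWalk.tendsto_geometricTensor hθ Ψ₀ μ ν
  have h2 := QWalk.tendsto_geometricTensor hθ Ψ₀ ν μ
  -- Both index orders now have the same limit: half their sum is the Fisher limit, and their
  -- difference, the Uhlmann part, vanishes.
  rw [QWalk.asymptoticTensor_comm hθ] at h2
  have hF : Tendsto
      (fun t : ℕ => QWalk.qfi (QWalk.densityAt Ψ₀ t Θ) (L t μ) (L t ν) / (t : ℂ) ^ 2) atTop
      (𝓝 (QWalk.asymptoticTensor Ψ₀ Θ μ ν)) := by
    convert! (h1.add h2).const_mul (1 / 2 : ℂ) using 1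
    · ext t
      rw [QWalk.qfi_eq hΨ (hL t μ) (hL t ν)]
      ring
    · ring_nf
  refine ⟨hF, fun hρ => ?_, ?_⟩
  · rw [QWalk.asymptoticTensor, QWalk.kInt_congr_ae
      (g := fun k => QWalk.form k Θ (QWalk.genAt k Θ μ) (QWalk.genAt k Θ ν))] at hF
    · exact hF
    · filter_upwards [hρ] with k hk
      rw [hk, one_mul]
  · convert! (h1.sub h2).const_mul (-(Complex.I / 2)) using 1
    · ext t
      rw [QWalk.uhlmann_eq hΨ (hL t μ) (hL t ν)]
      ring
    · simp
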